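/- **Setting.** Let $n,m\ge 0$, let $\mathcal Q_s=\{1,\dots,\bar q\}$ with $\bar q\ge 1$ be a finite set of modes, and let $T>0$, $k\ge 1$, $\tau_d>0$, $N_0\ge 1$ be real. For each $q\in\mathcal Q_s$ let $R_q:\mathbb R^n\to\mathbb R^n$ be continuous and let $f_q(x,u,\tau,\mu)\in\mathbb R^n$ be locally Lipschitz on $\mathbb R^n\times\mathbb R^m\times[0,\infty)\times[1,\infty)$ (the case where $f_q$ does not depend on $\mu$ is included). Consider the hybrid system with state $z=(x,\tau,q,\mu_k)\in\mathbb R^{n+3}$ and input $u\in\mathbb R^m$: - flows: on $C=\mathbb R^n\times[0,N_0]\times\mathcal Q_s\times[1,\infty)$, $\ \dot x=\mu_k f_q(x,u,\tau,\mu_k)$, $\ \dot\tau\in[0,\mu_k/\tau_d]$, $\ \dot q=0$, $\ \dot\mu_k=\frac kT\mu_k^{1+1/k}$; - jumps: on $D=\mathbb R^n\times[1,N_0]\times\mathcal Q_s\times[1,\infty)$, $\ x^+=R_q(x)$, $\ \tau^+=\tau-1$, $\ q^+\in\mathcal Q_s\setminus\{q\}$, $\ \mu_k^+=\mu_k$.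 Solutions are solution pairs $(z,u)$ on a common hybrid time domain: $z(\cdot,j)$ is locally absolutely continuous, $u(\cdot,j)$ is Lebesgue measurable and locally essentially bounded, $z(0,0)\in C\cup D$, the flow inclusion and $z\in C$ hold for almost every $t$ in each interval of flow with nonempty interior, and at each jump $z\in D$ and the jump inclusion holds; maximality is not required. Write $|u|_{(t,j)}$ for the supremum of $|u(t',j')|$ over $(t',j')\in\mathrm{dom}(z)$, $(t',j')\le(t,j)$. With $\mu_0=\mu_k(0,0)$ let $\Upsilon=T\mu_0^{-1/k}$, $\mu_k(t)=T^k/(\Upsilon-t)^k$, and let the dilated time be $$\mathcal T_k(t)=\frac{T}{k-1}\Big(\mu_k(t)^{\frac{k-1}{k}}-\mu_0^{\frac{k-1}{k}}\Big)\ (k>1),\qquad \mathcal T_1(t)=T\ln\frac{\mu_1(t)}{\mu_0}.$$ Let $\mathcal A=\{0\}\times[0,N_0]\times\mathcal Q_s\times[1,\infty)$ and let $|z|_{\mathcal A}$ be the Euclidean distance to $\mathcal A$. A function $\gamma:[0,\infty)\to[0,\infty)$ is of class $\mathcal K$ if it is continuous, strictly increasing and $\gamma(0)=0$; $\beta:[0,\infty)^2\to[0,\infty)$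 is of class $\mathcal{KL}$ if it is nondecreasing in the first argument, nonincreasing in the second, $\lim_{\rho\to0^+}\beta(\rho,s)=0$ for each $s$ and $\lim_{s\to\infty}\beta(\rho,s)=0$ for each $\rho$; $\beta:[0,\infty)^3\to[0,\infty)$ is of class $\mathcal{KLL}$ if $\beta(\cdot,s,\cdot)$ and $\beta(\cdot,\cdot,s)$ are of class $\mathcal{KL}$ for every $s\ge 0$. The set $\mathcal A$ is - *prescribed-time input-to-state stable via flows* (PT-ISS$_F$) if there are $\beta\in\mathcal{KLL}$, $\gamma\in\mathcal K$ such that every solution pair satisfies, for all $(t,j)\in\mathrm{dom}(z)$ with $|u|_{(t,j)}<\infty$, $$|z(t,j)|_{\mathcal A}\le\beta\big(|z(0,0)|_{\mathcal A},\mathcal T_k(t),j\big)+\gamma\big(|u|_{(t,j)}\big);\tag{1}$$ - *prescribed-time stable via flows* (PT-S$_F$) if $|z(t,j)|_{\mathcal A}\le\beta(|z(0,0)|_{\mathcal A},\mathcal T_k(t),j)$ holds, with some $\beta\in\mathcal{KLL}$, for all solution pairs with $u\equiv0$; - *prescribed-time input-to-state stable with convergence via flows* (PT-ISS-C$_F$)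 if there are $\beta\in\mathcal{KLL}$, $\gamma\in\mathcal K$, $\beta_c\in\mathcal{KL}$ such that every solution pair satisfies, for all $(t,j)\in\mathrm{dom}(z)$ with $|u|_{(t,j)}<\infty$, $$|z(t,j)|_{\mathcal A}\le\beta_c\Big(\beta\big(|z(0,0)|_{\mathcal A},\mathcal T_k(t),j\big)+\gamma\big(|u|_{(t,j)}\big),\mathcal T_k(t)\Big).\tag{2}$$ **Lyapunov condition for $\Delta:[1,\infty)\to[0,\infty)$.** There are smooth $V_q:\mathbb R^n\times[0,\infty)\to[0,\infty)$ and constants $c_{q,1},\dots,c_{q,4}>0$ $(q\in\mathcal Q_s)$, $p>0$, $\chi\in(0,1]$ such that - $c_{q,1}|x|^p\le V_q(x,\tau)\le c_{q,2}|x|^p$ for all $x\in\mathbb R^n$, $\tau\in[0,N_0]$, $q\in\mathcal Q_s$; - $\langle\nabla V_q(x,\tau),(f_q(x,u,\tau,\mu),\eta)\rangle\le -c_{q,3}V_q(x,\tau)+c_{q,4}\Delta(\mu)|u|^p$ for all $x\in\mathbb R^n$, $u\in\mathbb R^m$, $\tau\in[0,N_0]$, $q\in\mathcal Q_s$, $\mu\ge1$,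 $\eta\in[0,1/\tau_d]$; - $V_q(R_o(x),\tau-1)\le\chi V_o(x,\tau)$ for all $x\in\mathbb R^n$, $\tau\in[1,N_0]$ and $o\ne q$ in $\mathcal Q_s$. Put $r=\max_q c_{q,2}/\min_q c_{q,1}$, $\lambda=\min_q c_{q,3}-\ln(r)/\tau_d$, and $$\kappa_1=\big(r^{N_0}r\big)^{1/p}e^{\frac{\lambda}{2p}\frac{\tau_d}{1+\tau_d}N_0},\quad \kappa_2=\frac{\lambda\tau_d}{2p(1+\tau_d)},\quad \kappa_3=\Big(\frac{2\,r^{N_0}\max_q c_{q,4}}{\lambda\min_q c_{q,1}}\Big)^{1/p}.$$ **Theorem.** Suppose that $\tau_d>\ln(r)/\min_q c_{q,3}$. (a) If the Lyapunov condition holds with $\Delta=0$, then $\mathcal A$ is PT-S$_F$; moreover every solution pair (with any input $u$) satisfies $|z(t,j)|_{\mathcal A}\le\kappa_1e^{-\kappa_2(\mathcal T_k(t)+j)}|z(0,0)|_{\mathcal A}$ for all $(t,j)\in\mathrm{dom}(z)$ with $|u|_{(t,j)}<\infty$. (b) If it holds with $\Delta=1$, then $\mathcal A$ is PT-ISS$_F$;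 moreover (1) holds with $\beta(\rho,s,j)=\kappa_1e^{-\kappa_2(s+j)}\rho$ and $\gamma(\rho)=\kappa_3\rho$. (c) If it holds with $\Delta(\mu)=\mu^{-\ell}$ for some $\ell>0$, then $\mathcal A$ is PT-ISS-C$_F$; moreover (2) holds with $\beta(\rho,s,j)=\kappa_1^2e^{-\frac{\kappa_2}{2}(s+j)}\rho$, $\gamma(\rho)=2\kappa_1\kappa_3\rho$ and some $\beta_c\in\mathcal{KL}$. -/

import Mathlib

open Set Filter Topology MeasureTheory

noncomputable section

/-! ## Comparison functions -/

/-- Class `𝒦`: continuous, strictly increasing on `[0,∞)`, zero at zero. -/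
structure IsClassK (γ : ℝ → ℝ) : Prop where
  continuousOn : ContinuousOn γ (Ici 0)
  strictMonoOn : StrictMonoOn γ (Ici 0)
  map_zero : γ 0 = 0

/-- Class `𝒦ℒ` functions `[0,∞) × [0,∞) → [0,∞)`. -/
structure IsClassKL (β : ℝ → ℝ → ℝ) : Prop where
  nonneg : ∀ r, 0 ≤ r → ∀ s, 0 ≤ s → 0 ≤ β r s
  monotoneOn : ∀ s, 0 ≤ s → MonotoneOn (fun r => β r s) (Ici 0)
  antitoneOn : ∀ r, 0 ≤ r → AntitoneOn (fun s => β r s) (Ici 0)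
  tendsto_left : ∀ s, 0 ≤ s → Tendsto (fun r => β r s) (𝓝[>] 0) (𝓝 0)
  tendsto_right : ∀ r, 0 ≤ r → Tendsto (fun s => β r s) atTop (𝓝 0)

/-- Class `𝒦ℒℒ`. -/
def IsClassKLL (β : ℝ → ℝ → ℝ → ℝ) : Prop :=
  ∀ s, 0 ≤ s → IsClassKL (fun r t => β r s t) ∧ IsClassKL (fun r t => β r t s)

/-! ## Hybrid time domains, hybrid arcs and solution pairs -/

/-- `E` is the finite union of the sets `[t_j, t_{j+1}] × {j}`, `j < J`, with
`0 = t_0 ≤ t_1 ≤ ⋯ ≤ t_J`. -/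
def IsCompactHTD (E : Set (ℝ × ℕ)) : Prop :=
  ∃ (J : ℕ) (θ : ℕ → ℝ), θ 0 = 0 ∧ (∀ i < J, θ i ≤ θ (i + 1)) ∧
    E = {e | e.2 < J ∧ e.1 ∈ Icc (θ e.2) (θ (e.2 + 1))}

/-- Hybrid time domain. -/
def IsHTD (E : Set (ℝ × ℕ)) : Prop :=
  (∀ e ∈ E, 0 ≤ e.1) ∧
    ∀ e ∈ E, IsCompactHTD (E ∩ {e' | e'.1 ∈ Icc 0 e.1 ∧ e'.2 ≤ e.2})

/-- The interval `I_j` of flow times with jump counter `j`. -/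
def flowInterval (E : Set (ℝ × ℕ)) (j : ℕ) : Set ℝ := {t | (t, j) ∈ E}

/-- Hybrid input on `E`: each `u(·, j)` is Lebesgue measurable and locally essentially bounded. -/
def IsHybridInput {U : Type*} [NormedAddCommGroup U] (E : Set (ℝ × ℕ)) (u : ℝ → ℕ → U) : Prop :=
  ∀ j, AEStronglyMeasurable (fun t => u t j) (volume.restrict (flowInterval E j)) ∧
    ∀ a b, Icc a b ⊆ flowInterval E j →
      ∃ M : ℝ, ∀ᵐ t ∂(volume.restrict (Icc a b)), ‖u t j‖ ≤ M

/-- Hybrid arc on `E`: `z(·, j)` is locally absolutely continuous whenever `I_j` has nonempty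
interior. -/
def IsHybridArc {Z : Type*} [NormedAddCommGroup Z] (E : Set (ℝ × ℕ)) (z : ℝ → ℕ → Z) : Prop :=
  ∀ j, (interior (flowInterval E j)).Nonempty →
    ∀ a b, a ≤ b → Icc a b ⊆ flowInterval E j →
      AbsolutelyContinuousOnInterval (fun t => z t j) a b

/-- Data of a hybrid dynamical system with inputs, `ż ∈ F(z,u)` for `(z,u) ∈ C × U` and
`z⁺ ∈ G(z)` for `(z,u) ∈ D × U`. -/
structure HybridSystem (Z U : Type*) where
  C : Set Z
  F : Z → U → Set Z
  D : Set Z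
  G : Z → Set Z

/-- `(z, u)` is a solution pair with (common) hybrid time domain `E`. Signals are total functions of
which only the values on `E` matter. -/
structure HybridSystem.IsSolutionPair {Z U : Type*} [NormedAddCommGroup Z] [NormedSpace ℝ Z]
    [NormedAddCommGroup U] (H : HybridSystem Z U) (E : Set (ℝ × ℕ)) (z : ℝ → ℕ → Z)
    (u : ℝ → ℕ → U) : Prop where
  isHTD : IsHTD E
  zero_mem : ((0 : ℝ), 0) ∈ E
  isHybridArc : IsHybridArc E z
  isHybridInput : IsHybridInput E u
  init : z 0 0 ∈ H.C ∪ H.D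
  flow : ∀ j, (interior (flowInterval E j)).Nonempty →
    ∀ᵐ t ∂(volume.restrict (flowInterval E j)),
      z t j ∈ H.C ∧ ∃ v ∈ H.F (z t j) (u t j), HasDerivAt (fun s => z s j) v t
  jump : ∀ t j, (t, j) ∈ E → (t, j + 1) ∈ E → z t j ∈ H.D ∧ z t (j + 1) ∈ H.G (z t j)

/-- The values `|u(t', j')|` over `(t', j') ∈ E` with `(0,0) ≤ (t', j') ≤ (t, j)`. -/
def inputNorms {U : Type*} [NormedAddCommGroup U] (E : Set (ℝ × ℕ)) (u : ℝ → ℕ → U)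
    (t : ℝ) (j : ℕ) : Set ℝ :=
  {a | ∃ t' j', (t', j') ∈ E ∧ t' ≤ t ∧ j' ≤ j ∧ a = ‖u t' j'‖}

/-- `|u|_{(t,j)}`, the supremum of `|u|` up to hybrid time `(t, j)`. -/
def supInput {U : Type*} [NormedAddCommGroup U] (E : Set (ℝ × ℕ)) (u : ℝ → ℕ → U)
    (t : ℝ) (j : ℕ) : ℝ := sSup (inputNorms E u t j)

/-! ## Blow-up gain and dilation of time -/

/-- The prescribed time `Υ_{T,k} = T μ₀^{-1/k}`. -/
def prescribedTime (T k μ₀ : ℝ) : ℝ := T * μ₀ ^ (-(1 / k))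

/-- The blow-up gain `μ_k(t) = T^k / (Υ_{T,k} - t)^k`. -/
def blowUpGain (T k μ₀ t : ℝ) : ℝ := T ^ k / (prescribedTime T k μ₀ - t) ^ k

/-- The function `ω_k(b, a)`; the value at `k = 1` is the limit for `k → 1⁺`
(see `tendsto_omegaFun`). -/
def omegaFun (T k b a : ℝ) : ℝ :=
  if k = 1 then T * (Real.log b - Real.log a)
  else T / k * ((b ^ ((k - 1) / k) - 1) / ((k - 1) / k) - (a ^ ((k - 1) / k) - 1) / ((k - 1) / k))

theorem tendsto_omegaFun (T : ℝ) {a b : ℝ} (ha : 1 ≤ a) (hb : 1 ≤ b) :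
    Tendsto (fun k => omegaFun T k b a) (𝓝[>] 1) (𝓝 (omegaFun T 1 b a)) := by
  have key : ∀ c : ℝ, 1 ≤ c →
      Tendsto (fun k : ℝ => (c ^ ((k - 1) / k) - 1) / ((k - 1) / k)) (𝓝[>] 1)
        (𝓝 (Real.log c)) := by
    intro c hc
    have hd : HasDerivAt (fun x : ℝ => c ^ x) (Real.log c) 0 := by
      have := (hasDerivAt_id (0 : ℝ)).const_rpow (lt_of_lt_of_le one_pos hc)
      simpa using this
    have h1 := hd.tendsto_slope
    have h2 : Tendsto (fun k : ℝ => (k - 1) / k) (𝓝[>] 1) (𝓝[≠] 0) := by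
      apply tendsto_nhdsWithin_iff.2
      constructor
      · have hc : ContinuousAt (fun k : ℝ => (k - 1) / k) 1 :=
          ContinuousAt.div (by fun_prop) continuousAt_id one_ne_zero
        have : Tendsto (fun k : ℝ => (k - 1) / k) (𝓝 1) (𝓝 0) := by
          simpa using hc.tendsto
        exact this.mono_left nhdsWithin_le_nhds
      · filter_upwards [self_mem_nhdsWithin] with k hk
        have hk' : (1 : ℝ) < k := hk
        exact (div_pos (by linarith) (by linarith)).ne'
    refine (h1.comp h2).congr fun k => ?_
    simp [slope_def_field]
  have hT : Tendsto (fun k : ℝ => T / k) (𝓝[>] 1) (𝓝 T) := by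
    have hc : ContinuousAt (fun k : ℝ => T / k) 1 :=
      ContinuousAt.div continuousAt_const continuousAt_id one_ne_zero
    have : Tendsto (fun k : ℝ => T / k) (𝓝 1) (𝓝 T) := by simpa using hc.tendsto
    exact this.mono_left nhdsWithin_le_nhds
  have h := hT.mul ((key b hb).sub (key a ha))
  have e : omegaFun T 1 b a = T * (Real.log b - Real.log a) := by simp [omegaFun]
  rw [e]
  refine h.congr' ?_
  filter_upwards [self_mem_nhdsWithin] with k hk
  have hk' : (1 : ℝ) < k := hk
  simp [omegaFun, hk'.ne']

/-- The dilated time `𝒯_k(t) = ω_k(μ_k(t), μ_k(0))`, where `μ_k(0) = μ₀`. -/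
def dilatedTime (T k μ₀ t : ℝ) : ℝ := omegaFun T k (blowUpGain T k μ₀ t) μ₀

/-! ## Hybrid systems with a blow-up gain, and prescribed-time stability via flows -/

/-- The data `(F_Ψ, G_Ψ, Ψ_C, Ψ_D)` of the `ψ`-component. -/
structure PTData (Ψ U : Type*) where
  ΨC : Set Ψ
  FΨ : Ψ → U → ℝ → Set Ψ
  ΨD : Set Ψ
  GΨ : Ψ → Set Ψ

/-- The hybrid system with state `z = (ψ, μ)`, flow `ψ̇ ∈ μ F_Ψ(ψ,u,μ)`, `μ̇ = (k/T) μ^{1+1/k}` on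
`Ψ_C × [1,∞)` and jumps `ψ⁺ ∈ G_Ψ(ψ)`, `μ⁺ = μ` on `Ψ_D × [1,∞)`. -/
def PTData.toHybridSystem {Ψ U : Type*} [NormedAddCommGroup Ψ] [NormedSpace ℝ Ψ]
    (P : PTData Ψ U) (T k : ℝ) : HybridSystem (Ψ × ℝ) U where
  C := {z | z.1 ∈ P.ΨC ∧ 1 ≤ z.2}
  F := fun z u => {w | ∃ v ∈ P.FΨ z.1 u z.2, w = (z.2 • v, k / T * z.2 ^ (1 + 1 / k))}
  D := {z | z.1 ∈ P.ΨD ∧ 1 ≤ z.2}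
  G := fun z => {w | ∃ v ∈ P.GΨ z.1, w = (v, z.2)}

/-- The set `𝒜 = 𝒜₁ × [1,∞)`. -/
def withGain {Ψ : Type*} (A₁ : Set Ψ) : Set (Ψ × ℝ) :=
  {z | z.1 ∈ A₁ ∧ 1 ≤ z.2}

/-- The distance `|z|_A` for the Euclidean norm on the product `Ψ × ℝ` (the norm that Lean puts on
`Ψ × ℝ` itself is the equivalent maximum norm, which matters only for derivatives and absolute
continuity, where the two agree). -/
def euclDist {Ψ : Type*} [NormedAddCommGroup Ψ] (z : Ψ × ℝ) (A : Set (Ψ × ℝ)) : ℝ :=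
  Metric.infDist (WithLp.toLp 2 z) (WithLp.toLp 2 '' A)

/-- All solution pairs satisfy
`|z(t,j)|_𝒜 ≤ β(|z(0,0)|_𝒜, 𝒯_k(t), j) + γ(|u|_{(t,j)})` wherever `|u|_{(t,j)}` is finite. -/
def PTData.ISSBound {Ψ U : Type*} [NormedAddCommGroup Ψ] [NormedSpace ℝ Ψ]
    [NormedAddCommGroup U] (P : PTData Ψ U) (T k : ℝ) (A₁ : Set Ψ)
    (β : ℝ → ℝ → ℝ → ℝ) (γ : ℝ → ℝ) : Prop :=
  ∀ (E : Set (ℝ × ℕ)) (z : ℝ → ℕ → Ψ × ℝ) (u : ℝ → ℕ → U),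
    (P.toHybridSystem T k).IsSolutionPair E z u →
    ∀ t j, (t, j) ∈ E → BddAbove (inputNorms E u t j) →
      euclDist (z t j) (withGain A₁) ≤
        β (euclDist (z 0 0) (withGain A₁)) (dilatedTime T k (z 0 0).2 t) j +
          γ (supInput E u t j)

/-- All solution pairs satisfy
`|z(t,j)|_𝒜 ≤ β_c(β(|z(0,0)|_𝒜, 𝒯_k(t), j) + γ(|u|_{(t,j)}), 𝒯_k(t))` wherever
`|u|_{(t,j)}` is finite. -/
def PTData.ConvergentISSBound {Ψ U : Type*} [NormedAddCommGroup Ψ] [NormedSpace ℝ Ψ]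
    [NormedAddCommGroup U] (P : PTData Ψ U) (T k : ℝ) (A₁ : Set Ψ)
    (β : ℝ → ℝ → ℝ → ℝ) (γ : ℝ → ℝ) (βc : ℝ → ℝ → ℝ) : Prop :=
  ∀ (E : Set (ℝ × ℕ)) (z : ℝ → ℕ → Ψ × ℝ) (u : ℝ → ℕ → U),
    (P.toHybridSystem T k).IsSolutionPair E z u →
    ∀ t j, (t, j) ∈ E → BddAbove (inputNorms E u t j) →
      euclDist (z t j) (withGain A₁) ≤
        βc (β (euclDist (z 0 0) (withGain A₁)) (dilatedTime T k (z 0 0).2 t) j +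
          γ (supInput E u t j)) (dilatedTime T k (z 0 0).2 t)

/-- Prescribed-time stability via flows: the bound with `u ≡ 0`. -/
def PTData.IsPTS {Ψ U : Type*} [NormedAddCommGroup Ψ] [NormedSpace ℝ Ψ]
    [NormedAddCommGroup U] (P : PTData Ψ U) (T k : ℝ) (A₁ : Set Ψ) : Prop :=
  ∃ β, IsClassKLL β ∧
    ∀ (E : Set (ℝ × ℕ)) (z : ℝ → ℕ → Ψ × ℝ) (u : ℝ → ℕ → U),
      (P.toHybridSystem T k).IsSolutionPair E z u → (∀ t j, (t, j) ∈ E → u t j = 0) →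
      ∀ t j, (t, j) ∈ E →
        euclDist (z t j) (withGain A₁) ≤
          β (euclDist (z 0 0) (withGain A₁)) (dilatedTime T k (z 0 0).2 t) j

/-- Prescribed-time input-to-state stability via flows. -/
def PTData.IsPTISS {Ψ U : Type*} [NormedAddCommGroup Ψ] [NormedSpace ℝ Ψ]
    [NormedAddCommGroup U] (P : PTData Ψ U) (T k : ℝ) (A₁ : Set Ψ) : Prop :=
  ∃ β γ, IsClassKLL β ∧ IsClassK γ ∧ P.ISSBound T k A₁ β γ

/-- Prescribed-time input-to-state stability with convergence, via flows. -/
def PTData.IsPTISSC {Ψ U : Type*} [NormedAddCommGroup Ψ] [NormedSpace ℝ Ψ]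
    [NormedAddCommGroup U] (P : PTData Ψ U) (T k : ℝ) (A₁ : Set Ψ) : Prop :=
  ∃ β γ βc, IsClassKLL β ∧ IsClassK γ ∧ IsClassKL βc ∧ P.ConvergentISSBound T k A₁ β γ βc

/-! ## R-switching systems with stable modes -/

/-- The state `ψ = (x, τ, q) ∈ ℝⁿ⁺²` with the Euclidean norm. -/
abbrev SwitchState (n : ℕ) : Type := EuclideanSpace ℝ (Fin n ⊕ Fin 2)

namespace SwitchState

/-- The plant state `x`. -/
def x {n : ℕ} (ψ : SwitchState n) : EuclideanSpace ℝ (Fin n) :=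
  WithLp.toLp 2 fun i => ψ (Sum.inl i)

/-- The dwell-time state `τ`. -/
def τ {n : ℕ} (ψ : SwitchState n) : ℝ := ψ (Sum.inr 0)

/-- The logic state `q`. -/
def q {n : ℕ} (ψ : SwitchState n) : ℝ := ψ (Sum.inr 1)

/-- The state `(x, τ, q)`. -/
def mk {n : ℕ} (x : EuclideanSpace ℝ (Fin n)) (τ q : ℝ) : SwitchState n :=
  WithLp.toLp 2 (Sum.elim (fun i => x i) ![τ, q])

end SwitchState

/-- The real number in `{1, …, N}` that represents the `i`-th mode. -/
def modeVal {N : ℕ} (i : Fin N) : ℝ := (i : ℕ) + 1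

/-- Data of the hybrid model of the switching system with modes `1, …, N`, vector fields `f i`,
reset maps `R i`, dwell time `τd` and chatter bound `N₀`. -/
def switchingData {n m N : ℕ}
    (f : Fin N → EuclideanSpace ℝ (Fin n) → EuclideanSpace ℝ (Fin m) → ℝ → ℝ →
      EuclideanSpace ℝ (Fin n))
    (R : Fin N → EuclideanSpace ℝ (Fin n) → EuclideanSpace ℝ (Fin n)) (τd N₀ : ℝ) :
    PTData (SwitchState n) (EuclideanSpace ℝ (Fin m)) where
  ΨC := {ψ | ψ.τ ∈ Icc 0 N₀ ∧ ∃ i : Fin N, ψ.q = modeVal i}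
  FΨ := fun ψ u μ => {w | ∃ i : Fin N, ψ.q = modeVal i ∧
    ∃ η ∈ Icc 0 (1 / τd), w = SwitchState.mk (f i ψ.x u ψ.τ μ) η 0}
  ΨD := {ψ | ψ.τ ∈ Icc 1 N₀ ∧ ∃ i : Fin N, ψ.q = modeVal i}
  GΨ := fun ψ => {w | ∃ i o : Fin N, ψ.q = modeVal i ∧ o ≠ i ∧
    w = SwitchState.mk (R i ψ.x) (ψ.τ - 1) (modeVal o)}

/-- The compact set `𝒜₁ = {0} × [0, N₀] × {1, …, N}`. -/
def switchingTarget (n N : ℕ) (N₀ : ℝ) : Set (SwitchState n) :=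
  {ψ | ψ.x = 0 ∧ ψ.τ ∈ Icc 0 N₀ ∧ ∃ i : Fin N, ψ.q = modeVal i}

/-- Regularity of the vector fields (on `ℝⁿ × ℝᵐ × [0,∞) × [1,∞)`) and of the reset maps. -/
structure RegularModes {n m N : ℕ}
    (f : Fin N → EuclideanSpace ℝ (Fin n) → EuclideanSpace ℝ (Fin m) → ℝ → ℝ →
      EuclideanSpace ℝ (Fin n))
    (R : Fin N → EuclideanSpace ℝ (Fin n) → EuclideanSpace ℝ (Fin n)) : Prop where
  locallyLipschitz : ∀ i, LocallyLipschitzOn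
    {y : EuclideanSpace ℝ (Fin n) × EuclideanSpace ℝ (Fin m) × ℝ × ℝ |
      0 ≤ y.2.2.1 ∧ 1 ≤ y.2.2.2}
    (fun y => f i y.1 y.2.1 y.2.2.1 y.2.2.2)
  continuous : ∀ i, Continuous (R i)

/-- Candidate Lyapunov functions `V_q(x, τ)` with constants. -/
structure LyapunovData (n N : ℕ) where
  V : Fin N → EuclideanSpace ℝ (Fin n) × ℝ → ℝ
  c₁ : Fin N → ℝ
  c₂ : Fin N → ℝ
  c₃ : Fin N → ℝ
  c₄ : Fin N → ℝ
  p : ℝ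
  χ : ℝ

/-- The Lyapunov conditions when all modes are stable; `Δ μ` weighs the effect of the input. The
functions `V_q` are defined on `ℝⁿ × [0,∞)`, and `⟨∇V_q, w⟩` is the derivative in direction `w`. -/
structure LyapunovData.IsLyapunov {n m N : ℕ} (L : LyapunovData n N)
    (f : Fin N → EuclideanSpace ℝ (Fin n) → EuclideanSpace ℝ (Fin m) → ℝ → ℝ →
      EuclideanSpace ℝ (Fin n))
    (R : Fin N → EuclideanSpace ℝ (Fin n) → EuclideanSpace ℝ (Fin n)) (τd N₀ : ℝ)
    (Δ : ℝ → ℝ) : Prop where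
  c₁_pos : ∀ q, 0 < L.c₁ q
  c₂_pos : ∀ q, 0 < L.c₂ q
  c₃_pos : ∀ q, 0 < L.c₃ q
  c₄_pos : ∀ q, 0 < L.c₄ q
  p_pos : 0 < L.p
  χ_mem : L.χ ∈ Ioc 0 1
  smooth : ∀ q, ContDiffOn ℝ (⊤ : ℕ∞) (L.V q) (univ ×ˢ Ici 0)
  nonneg : ∀ q x τ, 0 ≤ τ → 0 ≤ L.V q (x, τ)
  bounds : ∀ q x, ∀ τ ∈ Icc 0 N₀,
    L.c₁ q * ‖x‖ ^ L.p ≤ L.V q (x, τ) ∧ L.V q (x, τ) ≤ L.c₂ q * ‖x‖ ^ L.p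
  flow : ∀ q x, ∀ τ ∈ Icc 0 N₀, ∀ u : EuclideanSpace ℝ (Fin m), ∀ μ, 1 ≤ μ →
    ∀ η ∈ Icc 0 (1 / τd),
      fderivWithin ℝ (L.V q) (univ ×ˢ Ici 0) (x, τ) (f q x u τ μ, η) ≤
        -L.c₃ q * L.V q (x, τ) + L.c₄ q * Δ μ * ‖u‖ ^ L.p
  jump : ∀ o q, q ≠ o → ∀ x, ∀ τ ∈ Icc 1 N₀, L.V q (R o x, τ - 1) ≤ L.χ * L.V o (x, τ)

namespace LyapunovData

/-- The ratio `r = max_q c_{q,2} / min_q c_{q,1}`. -/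
def r {n N : ℕ} (L : LyapunovData n N) : ℝ := (⨆ q, L.c₂ q) / (⨅ q, L.c₁ q)

/-- `λ = min_q c_{q,3} - ln(r) / τ_d`. -/
def lam {n N : ℕ} (L : LyapunovData n N) (τd : ℝ) : ℝ := (⨅ q, L.c₃ q) - Real.log L.r / τd

/-- `κ₁ = (r^{N₀} r)^{1/p} exp (λ τ_d N₀ / (2 p (1 + τ_d)))`. -/
def κ₁ {n N : ℕ} (L : LyapunovData n N) (τd N₀ : ℝ) : ℝ :=
  (L.r ^ N₀ * L.r) ^ (1 / L.p) * Real.exp (L.lam τd / (2 * L.p) * (τd / (1 + τd)) * N₀)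

/-- `κ₂ = λ τ_d / (2 p (1 + τ_d))`. -/
def κ₂ {n N : ℕ} (L : LyapunovData n N) (τd : ℝ) : ℝ :=
  L.lam τd * τd / (2 * L.p * (1 + τd))

/-- `κ₃ = (2 max_q c_{q,4} r^{N₀} / (λ min_q c_{q,1}))^{1/p}`. -/
def κ₃ {n N : ℕ} (L : LyapunovData n N) (τd N₀ : ℝ) : ℝ :=
  (2 * (⨆ q, L.c₄ q) * L.r ^ N₀ / (L.lam τd * (⨅ q, L.c₁ q))) ^ (1 / L.p)

end LyapunovData

end

noncomputable section

/-! ## Absolutely continuous curves -/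

/-! The gain blows up so that the dilated time `s = ω_k(μ, μ₀)` satisfies `ds/dt = μ` along flows.
Measured in `s`, the factor `μ` disappears from the flow: the timer grows at rate at most `1/τd` and
the Lyapunov functions obey `dV/ds ≤ -c₃ V + c₄ Δ(μ) |u|^p`. Prescribed-time stability is thus
ordinary exponential stability in the variable `s`.

Three facts are propagated along a solution by induction over its hybrid time domain
(`IsHTD.induction`). The quantity `μ^(-1/k) + t/T` is conserved, which identifies `μ` with the
explicit blow-up gain. The quantity `τ + j - s/τd` never increases, so `j ≤ s/τd + N₀`, and decay in
`s` can be traded for decay in `s + j` (`exp_le_decay`). Finally, `e^(cs) (V - K μ^(-ℓ))` never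
increases (`IsFlowArc.lyapunov_le`): during flows because `K μ^(-ℓ)` is a supersolution of the
comparison equation, at jumps because `χ ≤ 1` and `μ` is unchanged. The rate used is `c = λ`, which
is at most `min c₃` once `r ≥ 1`.

For constant weight `Δ` one takes `ℓ = 0`, and `K` is the equilibrium level of the comparison
equation. For `Δ = μ^(-ℓ)` the supersolution itself tends to zero; since `s ≤ T (μ - μ₀)`
(`omegaFun_le`), one has `μ ≥ 1 + s/T`, and this decay becomes a function of `s` alone. The sandwich
bounds on `V` turn both estimates into bounds on `|x|`, which is the distance to the target
(`euclDist_switchingTarget`). -/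

theorem AbsolutelyContinuousOnInterval.lipschitzOnWith_comp {X Y : Type*} [PseudoMetricSpace X]
    [PseudoMetricSpace Y] {f : ℝ → X} {g : X → Y} {s : Set X} {K : NNReal} {a b : ℝ}
    (hf : AbsolutelyContinuousOnInterval f a b) (hg : LipschitzOnWith K g s)
    (hs : MapsTo f (uIcc a b) s) : AbsolutelyContinuousOnInterval (fun t => g (f t)) a b := by
  unfold AbsolutelyContinuousOnInterval at hf ⊢
  apply squeeze_zero' ?_ ?_ (by simpa using Tendsto.const_mul (K : ℝ) hf)
  · exact Eventually.of_forall fun _ => Finset.sum_nonneg fun i hi => dist_nonneg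
  rw [eventually_inf_principal]
  filter_upwards with ⟨n, I⟩ hnI
  simp only [Finset.mul_sum]
  gcongr with i hi
  exact hg.dist_le_mul _ (hs (hnI.1 i hi).1) _ (hs (hnI.1 i hi).2)

/-- A `C¹` map on a convex set is locally Lipschitz there, hence Lipschitz on the compact image of
the curve. The set need not be open: it will be `τ ≥ 0` for the Lyapunov functions and `μ ≥ 1` for
functions of the gain. -/
theorem AbsolutelyContinuousOnInterval.contDiffOn_comp {X Y : Type*} [NormedAddCommGroup X]
    [NormedSpace ℝ X] [NormedAddCommGroup Y] [NormedSpace ℝ Y] {f : ℝ → X} {g : X → Y}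
    {s : Set X} {a b : ℝ} (hf : AbsolutelyContinuousOnInterval f a b) (hg : ContDiffOn ℝ 1 g s)
    (hconv : Convex ℝ s) (hs : MapsTo f (uIcc a b) s) :
    AbsolutelyContinuousOnInterval (fun t => g (f t)) a b := by
  have hloc : LocallyLipschitzOn (f '' uIcc a b) g := by
    intro x hx
    obtain ⟨y, hy, rfl⟩ := hx
    obtain ⟨K, t, ht, hK⟩ := (hg (f y) (hs hy)).exists_lipschitzOnWith hconv
    exact ⟨K, t, nhdsWithin_mono _ hs.image_subset ht, hK⟩
  obtain ⟨K, hK⟩ := hloc.exists_lipschitzOnWith_of_compact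
    (isCompact_uIcc.image_of_continuousOn hf.continuousOn)
  exact hf.lipschitzOnWith_comp hK (mapsTo_image _ _)

theorem AbsolutelyContinuousOnInterval.clm_comp {X Y : Type*} [NormedAddCommGroup X]
    [NormedSpace ℝ X] [NormedAddCommGroup Y] [NormedSpace ℝ Y] {f : ℝ → X} {a b : ℝ}
    (hf : AbsolutelyContinuousOnInterval f a b) (g : X →L[ℝ] Y) :
    AbsolutelyContinuousOnInterval (fun t => g (f t)) a b :=
  hf.lipschitzOnWith_comp (g.lipschitz.lipschitzOnWith (s := univ)) (mapsTo_univ _ _)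

theorem AbsolutelyContinuousOnInterval.le_of_ae_deriv_nonpos {f : ℝ → ℝ} {a b : ℝ} (hab : a ≤ b)
    (hf : AbsolutelyContinuousOnInterval f a b)
    (hd : ∀ᵐ t ∂(volume.restrict (Icc a b)), ∃ v ≤ 0, HasDerivAt f v t) : f b ≤ f a := by
  have h := hf.integral_deriv_eq_sub
  have h2 : 0 ≤ ∫ t in a..b, -deriv f t := by
    apply intervalIntegral.integral_nonneg_of_ae_restrict hab
    filter_upwards [hd] with t ⟨v, hv, ht⟩
    simpa [ht.deriv] using hv
  rw [intervalIntegral.integral_neg] at h2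
  linarith

/-- A set of full measure is dense, so by continuity a closed constraint that holds almost
everywhere holds everywhere, endpoints included. -/
theorem ContinuousOn.forall_mem_of_ae_mem {X : Type*} [TopologicalSpace X] {f : ℝ → X} {a b : ℝ}
    (hab : a < b) (hf : ContinuousOn f (Icc a b)) {s : Set X} (hs : IsClosed s)
    (h : ∀ᵐ t ∂(volume.restrict (Icc a b)), f t ∈ s) : ∀ t ∈ Icc a b, f t ∈ s := by
  have hd : Ioo a b ⊆ closure (Ioo a b ∩ {t | f t ∈ s}) := by
    have h' : ∀ᵐ t ∂(volume.restrict (Ioo a b)), f t ∈ s :=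
      ae_restrict_of_ae_restrict_of_subset Ioo_subset_Icc_self h
    rw [ae_restrict_iff' measurableSet_Ioo] at h'
    have hdense : Dense {t | t ∈ Ioo a b → f t ∈ s} := Measure.dense_of_ae h'
    refine (hdense.open_subset_closure_inter isOpen_Ioo).trans (closure_mono ?_)
    exact fun t ht => ⟨ht.1, ht.2 ht.1⟩
  have hd' : Icc a b ⊆ closure (Ioo a b ∩ {t | f t ∈ s}) := by
    rw [← closure_Ioo hab.ne]
    exact closure_minimal hd isClosed_closure
  intro t ht
  have hc : ContinuousWithinAt f (Ioo a b ∩ {t | f t ∈ s}) t :=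
    (hf t ht).mono (inter_subset_left.trans Ioo_subset_Icc_self)
  have := hc.mem_closure_image (hd' ht)
  refine closure_minimal ?_ hs this
  rintro _ ⟨y, hy, rfl⟩
  exact hy.2

/-! ## Hybrid time domains -/

/-- Truncation at `(t, j)` leaves finitely many intervals, so ordinary induction on the jump counter
applies. The flow step keeps `b ≤ t` and `i ≤ j` because the input is bounded only up to `(t, j)`,
and it sees only nondegenerate intervals. -/
theorem IsHTD.induction {E : Set (ℝ × ℕ)} (hE : IsHTD E) {P : ℝ → ℕ → Prop} (h0 : P 0 0)
    {t : ℝ} {j : ℕ} (htj : (t, j) ∈ E)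
    (hflow : ∀ a b i, a < b → b ≤ t → i ≤ j → Icc a b ⊆ flowInterval E i → P a i → P b i)
    (hjump : ∀ a i, (a, i) ∈ E → (a, i + 1) ∈ E → P a i → P a (i + 1)) : P t j := by
  obtain ⟨J, θ, hθ0, hθ, hJ⟩ := hE.2 _ htj
  have hmem : ∀ i s, i < J → s ∈ Icc (θ i) (θ (i + 1)) → (s, i) ∈ E ∧ s ≤ t ∧ i ≤ j := by
    intro i s hi hs
    have : (s, i) ∈ E ∩ {e' | e'.1 ∈ Icc 0 (t, j).1 ∧ e'.2 ≤ (t, j).2} := by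
      rw [hJ]; exact ⟨hi, hs⟩
    exact ⟨this.1, this.2.1.2, this.2.2⟩
  have ht : (t, j) ∈ E ∩ {e' | e'.1 ∈ Icc 0 (t, j).1 ∧ e'.2 ≤ (t, j).2} :=
    ⟨htj, ⟨hE.1 _ htj, le_rfl⟩, le_rfl⟩
  rw [hJ] at ht
  have hstep : ∀ i s, i < J → s ∈ Icc (θ i) (θ (i + 1)) → P (θ i) i → P s i := by
    intro i s hi hs hP
    rcases hs.1.eq_or_lt with h | h
    · rwa [← h]
    · have hm := hmem i s hi hs
      exact hflow _ _ _ h hm.2.1 hm.2.2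
        (fun r hr => (hmem i r hi ⟨hr.1, hr.2.trans hs.2⟩).1) hP
  have hstart : ∀ i, i < J → P (θ i) i := by
    intro i
    induction i with
    | zero => intro _; rwa [hθ0]
    | succ i ih =>
      intro hi
      have hi' : i < J := by omega
      have hle := hθ i hi'
      refine hjump _ _ (hmem i _ hi' ⟨hle, le_rfl⟩).1
        (hmem (i + 1) _ hi ⟨le_rfl, hθ _ hi⟩).1 ?_
      exact hstep i _ hi' ⟨hle, le_rfl⟩ (ih hi')
  exact hstep j t ht.1 ht.2 (hstart j ht.1)

theorem flowInterval_interior_nonempty {E : Set (ℝ × ℕ)} {a b : ℝ} {j : ℕ} (hab : a < b)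
    (h : Icc a b ⊆ flowInterval E j) : (interior (flowInterval E j)).Nonempty := by
  have : (Ioo a b).Nonempty := nonempty_Ioo.2 hab
  exact this.mono (interior_maximal (Ioo_subset_Icc_self.trans h) isOpen_Ioo)

/-! ## The dilated time as a function of the gain -/

/-- One formula covers `k = 1` and `k > 1`; everything later uses only this derivative, so the two
cases never separate again. -/
theorem hasDerivAt_omegaFun {T k : ℝ} (hk : 1 ≤ k) (a : ℝ) {y : ℝ} (hy : 0 < y) :
    HasDerivAt (fun y => omegaFun T k y a) (T / k * y ^ (-(1 / k))) y := by
  by_cases h1 : k = 1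
  · subst h1
    simp only [omegaFun, if_true]
    have := ((Real.hasDerivAt_log hy.ne').sub_const (Real.log a)).const_mul T
    simpa [Real.rpow_neg_one] using this
  · simp only [omegaFun, if_neg h1]
    have hk0 : k ≠ 0 := by linarith
    have hk1 : k - 1 ≠ 0 := sub_ne_zero.2 h1
    have h := ((((Real.hasDerivAt_rpow_const (p := (k - 1) / k)
      (Or.inl hy.ne')).sub_const 1).div_const ((k - 1) / k)).sub_const
        ((a ^ ((k - 1) / k) - 1) / ((k - 1) / k))).const_mul (T / k)
    refine h.congr_deriv ?_
    have : (k - 1) / k - 1 = -(1 / k) := by field_simp; ring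
    rw [this]
    field_simp

theorem omegaFun_self (T k a : ℝ) : omegaFun T k a a = 0 := by
  simp [omegaFun]

theorem contDiffOn_omegaFun (T k a : ℝ) :
    ContDiffOn ℝ 1 (fun y => omegaFun T k y a) (Ici 1) := by
  have hne : ∀ y ∈ Ici (1 : ℝ), y ≠ 0 := fun y hy => (lt_of_lt_of_le one_pos hy).ne'
  by_cases h1 : k = 1
  · simp only [omegaFun, if_pos h1]
    exact contDiffOn_const.mul ((contDiffOn_id.log hne).sub contDiffOn_const)
  · simp only [omegaFun, if_neg h1]
    exact contDiffOn_const.mul ((((contDiffOn_id.rpow_const_of_ne hne).sub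
      contDiffOn_const).div_const _).sub contDiffOn_const)

theorem omegaFun_nonneg {T k a b : ℝ} (hT : 0 < T) (hk : 1 ≤ k) (ha : 1 ≤ a) (hab : a ≤ b) :
    0 ≤ omegaFun T k b a := by
  have h : MonotoneOn (fun y => omegaFun T k y a) (Ici 1) := by
    apply monotoneOn_of_deriv_nonneg (convex_Ici 1) (contDiffOn_omegaFun T k a).continuousOn
    · intro y hy
      rw [interior_Ici] at hy
      exact (hasDerivAt_omegaFun hk a (one_pos.trans hy)).differentiableAt.differentiableWithinAt
    · intro y hy
      rw [interior_Ici] at hy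
      have hy0 : 0 < y := one_pos.trans hy
      rw [(hasDerivAt_omegaFun hk a hy0).deriv]
      positivity
  have := h ha (ha.trans hab) hab
  simpa [omegaFun_self] using this

/-- The derivative `(T/k) y^(-1/k)` is at most `T` for `y ≥ 1`. The bound serves to estimate the
gain from below by the dilated time. -/
theorem omegaFun_le {T k a b : ℝ} (hT : 0 < T) (hk : 1 ≤ k) (ha : 1 ≤ a) (hab : a ≤ b) :
    omegaFun T k b a ≤ T * (b - a) := by
  have hd : ∀ y, 1 < y → HasDerivAt (fun y => omegaFun T k y a - T * y)
      (T / k * y ^ (-(1 / k)) - T * 1) y := fun y hy =>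
    (hasDerivAt_omegaFun hk a (one_pos.trans hy)).sub ((hasDerivAt_id y).const_mul T)
  have hc : ContinuousOn (fun y => omegaFun T k y a - T * y) (Ici 1) :=
    (contDiffOn_omegaFun T k a).continuousOn.sub (by fun_prop)
  have h : AntitoneOn (fun y => omegaFun T k y a - T * y) (Ici 1) := by
    apply antitoneOn_of_deriv_nonpos (convex_Ici 1) hc
    · intro y hy
      rw [interior_Ici] at hy
      exact (hd y hy).differentiableAt.differentiableWithinAt
    · intro y hy
      rw [interior_Ici] at hy
      have hy0 : 0 < y := one_pos.trans hy
      rw [(hd y hy).deriv]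
      have h1 : y ^ (-(1 / k)) ≤ 1 :=
        Real.rpow_le_one_of_one_le_of_nonpos (le_of_lt hy) (by simp; linarith)
      have h2 : T / k ≤ T := div_le_self hT.le hk
      have h3 : 0 ≤ y ^ (-(1 / k)) := by positivity
      nlinarith [mul_le_mul h2 h1 h3 hT.le]
  have := h ha (ha.trans hab) hab
  simp only [omegaFun_self] at this
  linarith

/-- The hypothesis says `Υ - t = T μ^(-1/k)`. In particular `t < Υ`, so the explicit gain is only
ever evaluated before its blow-up. -/
theorem blowUpGain_eq {T k μ₀ μ t : ℝ} (hT : 0 < T) (hk : 1 ≤ k) (hμ : 1 ≤ μ)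
    (h : μ ^ (-(1 / k)) + t / T = μ₀ ^ (-(1 / k))) : blowUpGain T k μ₀ t = μ := by
  have hμ0 : 0 < μ := by linarith
  have hk0 : k ≠ 0 := by linarith
  unfold blowUpGain prescribedTime
  have : T * μ₀ ^ (-(1 / k)) - t = T * μ ^ (-(1 / k)) := by
    rw [← h]; field_simp; ring
  rw [this, Real.mul_rpow hT.le (by positivity), ← Real.rpow_mul hμ0.le]
  have : -(1 / k) * k = -1 := by field_simp
  rw [this, Real.rpow_neg_one]
  have : T ^ k ≠ 0 := by positivity
  field_simp

/-! ## The components of the switching state -/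

namespace SwitchState

variable {n : ℕ}

/-- The projection to the plant state. -/
def xL (n : ℕ) : SwitchState n →L[ℝ] EuclideanSpace ℝ (Fin n) :=
  LinearMap.toContinuousLinearMap
    { toFun := x
      map_add' := fun _ _ => rfl
      map_smul' := fun _ _ => rfl }

/-- The projection to the dwell-time state. -/
def τL (n : ℕ) : SwitchState n →L[ℝ] ℝ :=
  LinearMap.toContinuousLinearMap
    { toFun := τ
      map_add' := fun _ _ => rfl
      map_smul' := fun _ _ => rfl }

/-- The projection to the logic state. -/
def qL (n : ℕ) : SwitchState n →L[ℝ] ℝ :=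
  LinearMap.toContinuousLinearMap
    { toFun := q
      map_add' := fun _ _ => rfl
      map_smul' := fun _ _ => rfl }

@[simp] theorem xL_apply (ψ : SwitchState n) : xL n ψ = ψ.x := rfl
@[simp] theorem τL_apply (ψ : SwitchState n) : τL n ψ = ψ.τ := rfl
@[simp] theorem qL_apply (ψ : SwitchState n) : qL n ψ = ψ.q := rfl
@[simp] theorem x_mk (x : EuclideanSpace ℝ (Fin n)) (τ q : ℝ) : (mk x τ q).x = x := rfl
@[simp] theorem τ_mk (x : EuclideanSpace ℝ (Fin n)) (τ q : ℝ) : (mk x τ q).τ = τ := rfl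
@[simp] theorem q_mk (x : EuclideanSpace ℝ (Fin n)) (τ q : ℝ) : (mk x τ q).q = q := rfl

theorem norm_sq_eq (ψ : SwitchState n) : ‖ψ‖ ^ 2 = ‖ψ.x‖ ^ 2 + ψ.τ ^ 2 + ψ.q ^ 2 := by
  simp only [EuclideanSpace.norm_sq_eq, Fintype.sum_sum_type, Fin.sum_univ_two, Real.norm_eq_abs,
    sq_abs, x, τ, q]
  ring

theorem norm_x_le (ψ : SwitchState n) : ‖ψ.x‖ ≤ ‖ψ‖ := by
  apply le_of_sq_le_sq _ (norm_nonneg _)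
  nlinarith [norm_sq_eq ψ, sq_nonneg ψ.τ, sq_nonneg ψ.q]

end SwitchState

theorem modeVal_injective {N : ℕ} : Function.Injective (modeVal : Fin N → ℝ) := by
  intro i j h
  simp only [modeVal, add_left_inj, Nat.cast_inj] at h
  exact Fin.ext h

/-- The distance to the target set is the norm of the plant state. -/
theorem euclDist_switchingTarget {n N : ℕ} {N₀ : ℝ} {z : SwitchState n × ℝ}
    (hτ : z.1.τ ∈ Icc 0 N₀) (hq : ∃ i : Fin N, z.1.q = modeVal i) (hμ : 1 ≤ z.2) :
    euclDist z (withGain (switchingTarget n N N₀)) = ‖z.1.x‖ := by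
  have hmem : (SwitchState.mk 0 z.1.τ z.1.q, z.2) ∈ withGain (switchingTarget n N N₀) :=
    ⟨⟨rfl, hτ, hq⟩, hμ⟩
  apply le_antisymm
  · refine (Metric.infDist_le_dist_of_mem (mem_image_of_mem _ hmem)).trans_eq ?_
    rw [WithLp.prod_dist_eq_of_L2]
    have h0 : dist z.1 (SwitchState.mk 0 z.1.τ z.1.q) = ‖z.1.x‖ := by
      rw [dist_eq_norm, ← sq_eq_sq₀ (norm_nonneg _) (norm_nonneg _), SwitchState.norm_sq_eq]
      simp only [← SwitchState.xL_apply, ← SwitchState.τL_apply, ← SwitchState.qL_apply, map_sub]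
      simp
    simp [h0]
  · rw [euclDist, Metric.le_infDist ⟨_, mem_image_of_mem _ hmem⟩]
    rintro _ ⟨y, hy, rfl⟩
    have h1 : ‖z.1.x‖ ≤ dist z.1 y.1 := by
      rw [dist_eq_norm]
      refine le_trans (le_of_eq ?_) (SwitchState.norm_x_le _)
      have hy0 : y.1.x = 0 := hy.1.1
      rw [← SwitchState.xL_apply (z.1 - y.1), map_sub]
      simp [hy0]
    rw [WithLp.prod_dist_eq_of_L2]
    apply Real.le_sqrt_of_sq_le
    have := pow_le_pow_left₀ (norm_nonneg _) h1 2
    exact this.trans (le_add_of_nonneg_right (sq_nonneg _))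

/-! ## Evolution during flows -/

section Flow

variable {n m N : ℕ}
  {f : Fin N → EuclideanSpace ℝ (Fin n) → EuclideanSpace ℝ (Fin m) → ℝ → ℝ →
    EuclideanSpace ℝ (Fin n)}
  {R : Fin N → EuclideanSpace ℝ (Fin n) → EuclideanSpace ℝ (Fin n)} {T k τd N₀ a b : ℝ}
  {z : ℝ → SwitchState n × ℝ} {u : ℝ → EuclideanSpace ℝ (Fin m)}

/-- A solution of the flow inclusion of the switching system on the interval `[a, b]`. -/
structure IsFlowArc
    (f : Fin N → EuclideanSpace ℝ (Fin n) → EuclideanSpace ℝ (Fin m) → ℝ → ℝ →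
      EuclideanSpace ℝ (Fin n)) (T k τd N₀ a b : ℝ)
    (z : ℝ → SwitchState n × ℝ) (u : ℝ → EuclideanSpace ℝ (Fin m)) : Prop where
  lt : a < b
  ac : AbsolutelyContinuousOnInterval z a b
  τ_mem : ∀ t ∈ Icc a b, (z t).1.τ ∈ Icc 0 N₀
  q_mem : ∀ t ∈ Icc a b, ∃ i : Fin N, (z t).1.q = modeVal i
  one_le : ∀ t ∈ Icc a b, 1 ≤ (z t).2
  deriv : ∀ᵐ t ∂(volume.restrict (Icc a b)), t ∈ Ioo a b ∧ ∃ i : Fin N, (z t).1.q = modeVal i ∧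
    ∃ η ∈ Icc 0 (1 / τd),
      HasDerivAt (fun s => (z s).1.x) ((z t).2 • f i (z t).1.x (u t) (z t).1.τ (z t).2) t ∧
      HasDerivAt (fun s => (z s).1.τ) ((z t).2 * η) t ∧
      HasDerivAt (fun s => (z s).1.q) 0 t ∧
      HasDerivAt (fun s => (z s).2) (k / T * (z t).2 ^ (1 + 1 / k)) t

theorem HybridSystem.IsSolutionPair.isFlowArc {E : Set (ℝ × ℕ)}
    {z : ℝ → ℕ → SwitchState n × ℝ} {u : ℝ → ℕ → EuclideanSpace ℝ (Fin m)}
    (h : ((switchingData f R τd N₀).toHybridSystem T k).IsSolutionPair E z u) {j : ℕ}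
    (hab : a < b) (hsub : Icc a b ⊆ flowInterval E j) :
    IsFlowArc f T k τd N₀ a b (fun t => z t j) (fun t => u t j) := by
  have hne := flowInterval_interior_nonempty hab hsub
  have hac := h.isHybridArc j hne a b hab.le hsub
  have hflow := ae_restrict_of_ae_restrict_of_subset hsub (h.flow j hne)
  have hcont : ContinuousOn (fun t => z t j) (Icc a b) := by
    simpa [uIcc_of_le hab.le] using hac.continuousOn
  have hclosed : IsClosed ((switchingData f R τd N₀).toHybridSystem T k).C := by
    have h1 : IsClosed {z : SwitchState n × ℝ | z.1.τ ∈ Icc 0 N₀} :=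
      isClosed_Icc.preimage ((SwitchState.τL n).continuous.comp continuous_fst)
    have h2 : IsClosed {z : SwitchState n × ℝ | ∃ i : Fin N, z.1.q = modeVal i} := by
      have : IsClosed (range (modeVal : Fin N → ℝ)) := (finite_range _).isClosed
      convert! this.preimage ((SwitchState.qL n).continuous.comp continuous_fst) using 1
      ext z
      simp [eq_comm]
    have h3 : IsClosed {z : SwitchState n × ℝ | 1 ≤ z.2} := isClosed_Ici.preimage continuous_snd
    exact (h1.inter h2).inter h3
  -- The definition of a solution grants the flow set only for almost every time; closedness of `C`
  -- extends this to all of `[a, b]`.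
  have hC := hcont.forall_mem_of_ae_mem hab hclosed (hflow.mono fun t ht => ht.1)
  refine ⟨hab, hac, fun t ht => (hC t ht).1.1, fun t ht => (hC t ht).1.2,
    fun t ht => (hC t ht).2, ?_⟩
  have hIoo : ∀ᵐ t ∂(volume.restrict (Icc a b)), t ∈ Ioo a b := by
    rw [← restrict_Ioo_eq_restrict_Icc]
    exact ae_restrict_mem measurableSet_Ioo
  filter_upwards [hflow, hIoo] with t ht htI
  obtain ⟨-, w, ⟨v, ⟨i, hi, η, hη, rfl⟩, rfl⟩, hd⟩ := ht
  have hd1 : HasDerivAt (fun s => (z s j).1) _ t := hd.fst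
  have hd2 : HasDerivAt (fun s => (z s j).2) _ t := hd.snd
  refine ⟨htI, i, hi, η, hη, ?_, ?_, ?_, hd2⟩
  · have := (SwitchState.xL n).hasFDerivAt.comp_hasDerivAt t hd1
    rwa [map_smul] at this
  · have := (SwitchState.τL n).hasFDerivAt.comp_hasDerivAt t hd1
    rwa [map_smul] at this
  · have := (SwitchState.qL n).hasFDerivAt.comp_hasDerivAt t hd1
    rw [map_smul] at this
    simpa using! this

namespace IsFlowArc

theorem ac_τ (h : IsFlowArc f T k τd N₀ a b z u) :
    AbsolutelyContinuousOnInterval (fun t => (z t).1.τ) a b :=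
  h.ac.clm_comp ((SwitchState.τL n).comp (ContinuousLinearMap.fst ℝ _ _))

theorem ac_q (h : IsFlowArc f T k τd N₀ a b z u) :
    AbsolutelyContinuousOnInterval (fun t => (z t).1.q) a b :=
  h.ac.clm_comp ((SwitchState.qL n).comp (ContinuousLinearMap.fst ℝ _ _))

theorem ac_gain (h : IsFlowArc f T k τd N₀ a b z u) :
    AbsolutelyContinuousOnInterval (fun t => (z t).2) a b :=
  h.ac.clm_comp (ContinuousLinearMap.snd ℝ _ _)

theorem ac_gain_comp (h : IsFlowArc f T k τd N₀ a b z u)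
    {g : ℝ → ℝ} (hg : ContDiffOn ℝ 1 g (Ici 1)) :
    AbsolutelyContinuousOnInterval (fun t => g (z t).2) a b :=
  h.ac_gain.contDiffOn_comp hg (convex_Ici 1)
    (by rw [uIcc_of_le h.lt.le]; exact fun t ht => h.one_le t ht)

theorem q_eq (h : IsFlowArc f T k τd N₀ a b z u)
    {t : ℝ} (ht : t ∈ Icc a b) : (z t).1.q = (z a).1.q := by
  have hd : ∀ᵐ t, t ∈ uIcc a b → HasDerivAt (fun t => (z t).1.q) 0 t := by
    rw [uIcc_of_le h.lt.le, ← ae_restrict_iff' measurableSet_Icc]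
    filter_upwards [h.deriv] with t ⟨_, i, _, η, _, _, _, hq, _⟩ using hq
  obtain ⟨C, hC⟩ := h.ac_q.const_of_ae_hasDerivAt_zero hd
  rw [uIcc_of_le h.lt.le] at hC
  rw [hC _ ht, hC _ (left_mem_Icc.2 h.lt.le)]

/-- The gain equation is linearised by the power `-1/k`: `μ^(-1/k)` has constant slope `-1/T`. -/
theorem gain_eq (h : IsFlowArc f T k τd N₀ a b z u)
    (hT : 0 < T) (hk : 1 ≤ k) :
    (z b).2 ^ (-(1 / k)) + b / T = (z a).2 ^ (-(1 / k)) + a / T := by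
  have hk0 : 0 < k := by linarith
  have hac : AbsolutelyContinuousOnInterval (fun t => (z t).2 ^ (-(1 / k)) + t / T) a b := by
    refine (h.ac_gain_comp (contDiffOn_id.rpow_const_of_ne
      fun y hy => (lt_of_lt_of_le one_pos hy).ne')).fun_add ?_
    exact ContDiffOn.absolutelyContinuousOnInterval (by fun_prop)
  have hd : ∀ᵐ t, t ∈ uIcc a b → HasDerivAt (fun t => (z t).2 ^ (-(1 / k)) + t / T) 0 t := by
    rw [uIcc_of_le h.lt.le, ← ae_restrict_iff' measurableSet_Icc]
    filter_upwards [h.deriv] with t ⟨ht, i, _, η, _, _, _, _, hμ⟩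
    have h1 : 0 < (z t).2 := by linarith [h.one_le t (Ioo_subset_Icc_self ht)]
    have := (hμ.rpow_const (p := -(1 / k)) (Or.inl h1.ne')).add ((hasDerivAt_id t).div_const T)
    refine this.congr_deriv ?_
    have e : (z t).2 ^ (1 + 1 / k) * (z t).2 ^ (-(1 / k) - 1) = 1 := by
      rw [← Real.rpow_add h1]
      ring_nf
      exact Real.rpow_zero _
    calc _ = -((z t).2 ^ (1 + 1 / k) * (z t).2 ^ (-(1 / k) - 1)) / T + 1 / T := by
          field_simp
      _ = 0 := by rw [e]; ring
  obtain ⟨C, hC⟩ := hac.const_of_ae_hasDerivAt_zero hd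
  rw [uIcc_of_le h.lt.le] at hC
  have ha := hC _ (left_mem_Icc.2 h.lt.le)
  have hb := hC _ (right_mem_Icc.2 h.lt.le)
  exact hb.trans ha.symm

/-- This is `ds/dt = μ`: the exponents `-1/k` and `1 + 1/k` add up to `1`. -/
theorem hasDerivAt_omegaFun (h : IsFlowArc f T k τd N₀ a b z u)
    (hT : 0 < T) (hk : 1 ≤ k) (c : ℝ) {t : ℝ} (ht : t ∈ Icc a b)
    (hμ : HasDerivAt (fun s => (z s).2) (k / T * (z t).2 ^ (1 + 1 / k)) t) :
    HasDerivAt (fun s => omegaFun T k (z s).2 c) (z t).2 t := by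
  have h1 : 0 < (z t).2 := by linarith [h.one_le t ht]
  refine ((_root_.hasDerivAt_omegaFun hk c h1).comp t hμ).congr_deriv ?_
  have hk0 : 0 < k := by linarith
  have e : (z t).2 ^ (-(1 / k)) * (z t).2 ^ (1 + 1 / k) = (z t).2 := by
    rw [← Real.rpow_add h1]
    ring_nf
    exact Real.rpow_one _
  calc _ = (z t).2 ^ (-(1 / k)) * (z t).2 ^ (1 + 1 / k) := by field_simp
    _ = _ := e

theorem τ_sub_le (h : IsFlowArc f T k τd N₀ a b z u)
    (hT : 0 < T) (hk : 1 ≤ k) (c : ℝ) :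
    (z b).1.τ - omegaFun T k (z b).2 c / τd ≤ (z a).1.τ - omegaFun T k (z a).2 c / τd := by
  have hac : AbsolutelyContinuousOnInterval
      (fun t => (z t).1.τ - 1 / τd * omegaFun T k (z t).2 c) a b :=
    h.ac_τ.fun_sub ((h.ac_gain_comp (contDiffOn_omegaFun T k c)).const_mul _)
  have := hac.le_of_ae_deriv_nonpos h.lt.le ?_
  · simp only [one_div_mul_eq_div] at this
    exact this
  · filter_upwards [h.deriv] with t ⟨ht, i, _, η, hη, _, hτ, _, hμ⟩
    have ht' := Ioo_subset_Icc_self ht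
    refine ⟨_, ?_, hτ.sub ((h.hasDerivAt_omegaFun hT hk c ht' hμ).const_mul _)⟩
    nlinarith [h.one_le t ht', hη.2]

/-- `V` is differentiable only within `τ ≥ 0`, and the timer may touch `0`. The curve stays in that
half-space on the whole open interval, so the chain rule within it still yields a two-sided
derivative in time. -/
theorem hasDerivAt_lyapunov (h : IsFlowArc f T k τd N₀ a b z u)
    {V : EuclideanSpace ℝ (Fin n) × ℝ → ℝ}
    (hV : ContDiffOn ℝ 1 V (univ ×ˢ Ici 0)) {t : ℝ} (ht : t ∈ Ioo a b)
    {v : EuclideanSpace ℝ (Fin n)} {η : ℝ}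
    (hx : HasDerivAt (fun s => (z s).1.x) ((z t).2 • v) t)
    (hτ : HasDerivAt (fun s => (z s).1.τ) ((z t).2 * η) t) :
    HasDerivAt (fun s => V ((z s).1.x, (z s).1.τ))
      ((z t).2 * fderivWithin ℝ V (univ ×ˢ Ici 0) ((z t).1.x, (z t).1.τ) (v, η)) t := by
  have hmaps : MapsTo (fun s => ((z s).1.x, (z s).1.τ)) (Ioo a b) (univ ×ˢ Ici 0) :=
    fun s hs => ⟨mem_univ _, (h.τ_mem s (Ioo_subset_Icc_self hs)).1⟩
  have hd := (hV.differentiableOn one_ne_zero _ (hmaps ht)).hasFDerivWithinAt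
  have := (hd.comp_hasDerivWithinAt t (hx.prodMk hτ).hasDerivWithinAt hmaps).hasDerivAt
    (Ioo_mem_nhds ht.1 ht.2)
  refine this.congr_deriv ?_
  rw [← smul_eq_mul (z t).2 η, ← Prod.smul_mk, map_smul, smul_eq_mul]

end IsFlowArc

/-- Here `W'` is the derivative with respect to dilated time. In that time `μ^(-ℓ)` decays at
relative rate `ℓ (k/T) μ^(1/k - 1) ≤ ℓ k/T`, because `μ^(1/k) ≤ μ`. Hence the margin `c - ℓ k/T` on
the input term makes `K μ^(-ℓ)` a supersolution. -/
theorem supersolution_deriv_nonpos {T k μ c K ℓ W W' e : ℝ} (h1 : 1 ≤ μ) (hT : 0 < T) (hk : 1 ≤ k)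
    (hK : 0 ≤ K) (hℓ : 0 ≤ ℓ) (he : 0 ≤ e)
    (hW' : W' ≤ -c * W + (c - ℓ * (k / T)) * (K * μ ^ (-ℓ))) :
    e * (c * μ) * (W - K * μ ^ (-ℓ)) +
      e * (μ * W' - K * (k / T * μ ^ (1 + 1 / k) * -ℓ * μ ^ (-ℓ - 1))) ≤ 0 := by
  have h0 : 0 < μ := by linarith
  have hB' : k / T * μ ^ (1 + 1 / k) * -ℓ * μ ^ (-ℓ - 1) =
      -(ℓ * (k / T) * (μ ^ (-ℓ) * μ ^ (1 / k))) := by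
    have : μ ^ (1 + 1 / k) * μ ^ (-ℓ - 1) = μ ^ (-ℓ) * μ ^ (1 / k) := by
      rw [← Real.rpow_add h0, ← Real.rpow_add h0]
      ring_nf
    rw [← this]; ring
  have hμk : μ ^ (1 / k) ≤ μ := by
    have : μ ^ (1 / k) ≤ μ ^ (1 : ℝ) :=
      Real.rpow_le_rpow_of_exponent_le h1 (by rw [div_le_one (by linarith)]; exact hk)
    rwa [Real.rpow_one] at this
  have hkT : 0 ≤ K * (ℓ * (k / T) * μ ^ (-ℓ)) := by
    have : 0 < k := by linarith
    positivity
  have h2 := mul_le_mul_of_nonneg_left hW' h0.le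
  have h3 := mul_le_mul_of_nonneg_left hμk hkT
  rw [hB']
  have key : c * μ * (W - K * μ ^ (-ℓ)) +
      (μ * W' - K * -(ℓ * (k / T) * (μ ^ (-ℓ) * μ ^ (1 / k)))) ≤ 0 := by
    linarith
  have := mul_nonpos_of_nonneg_of_nonpos he key
  linarith

/-- During flows, the excess of the Lyapunov function over the supersolution `K μ ^ (-ℓ)`, scaled by
the exponential of the dilated time, does not increase. -/
theorem IsFlowArc.lyapunov_le (h : IsFlowArc f T k τd N₀ a b z u) (hT : 0 < T) (hk : 1 ≤ k)
    {L : LyapunovData n N} {Δ : ℝ → ℝ} (hL : L.IsLyapunov f R τd N₀ Δ) (hΔ : ∀ μ, 1 ≤ μ → 0 ≤ Δ μ)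
    {S : ℝ} (hS : ∀ t ∈ Icc a b, ‖u t‖ ≤ S) {c K ℓ : ℝ} (hc : ∀ i, c ≤ L.c₃ i)
    (hK : 0 ≤ K) (hℓ : 0 ≤ ℓ)
    (hdom : ∀ i, ∀ μ, 1 ≤ μ → L.c₄ i * Δ μ * S ^ L.p ≤ (c - ℓ * (k / T)) * (K * μ ^ (-ℓ)))
    (μ₀ : ℝ) {i : Fin N} (hi : (z a).1.q = modeVal i) :
    Real.exp (c * omegaFun T k (z b).2 μ₀) * (L.V i ((z b).1.x, (z b).1.τ) - K * (z b).2 ^ (-ℓ)) ≤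
    Real.exp (c * omegaFun T k (z a).2 μ₀) * (L.V i ((z a).1.x, (z a).1.τ) - K * (z a).2 ^ (-ℓ))
    := by
  have hV : ContDiffOn ℝ 1 (L.V i) (univ ×ˢ Ici 0) := (hL.smooth i).of_le (by simp)
  have hne : ∀ y ∈ Ici (1 : ℝ), y ≠ 0 := fun y hy => (lt_of_lt_of_le one_pos hy).ne'
  have hacW : AbsolutelyContinuousOnInterval (fun t => L.V i ((z t).1.x, (z t).1.τ)) a b := by
    refine (h.ac.clm_comp (((SwitchState.xL n).prod (SwitchState.τL n)).comp
      (ContinuousLinearMap.fst ℝ _ _))).contDiffOn_comp hV (convex_univ.prod (convex_Ici 0)) ?_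
    rw [uIcc_of_le h.lt.le]
    exact fun t ht => ⟨mem_univ _, (h.τ_mem t ht).1⟩
  have hac1 : AbsolutelyContinuousOnInterval
      (fun t => Real.exp (c * omegaFun T k (z t).2 μ₀)) a b :=
    h.ac_gain_comp (g := fun y => Real.exp (c * omegaFun T k y μ₀))
      (contDiffOn_const.mul (contDiffOn_omegaFun T k μ₀)).exp
  have hac2 : AbsolutelyContinuousOnInterval (fun t => K * (z t).2 ^ (-ℓ)) a b :=
    h.ac_gain_comp (g := fun y => K * y ^ (-ℓ))
      (contDiffOn_const.mul (contDiffOn_id.rpow_const_of_ne hne))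
  refine (hac1.fun_mul (hacW.fun_sub hac2)).le_of_ae_deriv_nonpos h.lt.le ?_
  filter_upwards [h.deriv] with t ⟨ht, i', hi', η, hη, hx, hτ, _, hμ⟩
  have ht' := Ioo_subset_Icc_self ht
  -- The mode that drives the flow at time `t` is the initial one, as `q` is constant during flows.
  obtain rfl : i' = i := modeVal_injective (by rw [← hi', ← hi, h.q_eq ht'])
  have h1 := h.one_le t ht'
  have h0 : 0 < (z t).2 := by linarith
  have hω := ((h.hasDerivAt_omegaFun hT hk μ₀ ht' hμ).const_mul c).exp
  have hW := h.hasDerivAt_lyapunov hV ht hx hτ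
  have hB := (hμ.rpow_const (p := -ℓ) (Or.inl h0.ne')).const_mul K
  refine ⟨_, ?_, hω.mul (hW.sub hB)⟩
  refine supersolution_deriv_nonpos h1 hT hk hK hℓ (Real.exp_pos _).le ?_
  have hflow := hL.flow i' (z t).1.x (z t).1.τ (h.τ_mem t ht') (u t) _ h1 η hη
  have hW0 := hL.nonneg i' (z t).1.x (z t).1.τ (h.τ_mem t ht').1
  have hu : L.c₄ i' * Δ (z t).2 * ‖u t‖ ^ L.p ≤ L.c₄ i' * Δ (z t).2 * S ^ L.p :=
    mul_le_mul_of_nonneg_left (Real.rpow_le_rpow (norm_nonneg _) (hS t ht') hL.p_pos.le)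
      (mul_nonneg (hL.c₄_pos i').le (hΔ _ h1))
  -- Lowering the rate from `c₃` to the common `c` needs `V ≥ 0`.
  linarith [hdom i' _ h1, mul_le_mul_of_nonneg_right (hc i') hW0]

end Flow

/-! ## Bounds along solution pairs -/

/-- What the flow of the timer, the mode and the gain yields at hybrid time `(t, j)` for a state `z`
with initial value `z₀`. -/
structure TimerBound {n : ℕ} (N : ℕ) (T k τd N₀ : ℝ) (z₀ : SwitchState n × ℝ) (t : ℝ) (j : ℕ)
    (z : SwitchState n × ℝ) : Prop where
  τ_mem : z.1.τ ∈ Icc 0 N₀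
  q_mem : ∃ i : Fin N, z.1.q = modeVal i
  one_le : 1 ≤ z.2
  gain_eq : z.2 ^ (-(1 / k)) + t / T = z₀.2 ^ (-(1 / k))
  dwell : z.1.τ + j - omegaFun T k z.2 z₀.2 / τd ≤ N₀

/-- The Lyapunov estimate for a state `z` with initial value `z₀`. -/
def LyapunovBound {n N : ℕ} (L : LyapunovData n N) (T k c K ℓ : ℝ) (z₀ z : SwitchState n × ℝ) :
    Prop :=
  ∀ i : Fin N, z.1.q = modeVal i → ∃ i₀ : Fin N,
    Real.exp (c * omegaFun T k z.2 z₀.2) * (L.V i (z.1.x, z.1.τ) - K * z.2 ^ (-ℓ)) ≤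
      L.V i₀ (z₀.1.x, z₀.1.τ) - K * z₀.2 ^ (-ℓ)

theorem HybridSystem.IsSolutionPair.init_mem {n m N : ℕ}
    {f : Fin N → EuclideanSpace ℝ (Fin n) → EuclideanSpace ℝ (Fin m) → ℝ → ℝ →
      EuclideanSpace ℝ (Fin n)}
    {R : Fin N → EuclideanSpace ℝ (Fin n) → EuclideanSpace ℝ (Fin n)} {T k τd N₀ : ℝ}
    {E : Set (ℝ × ℕ)} {z : ℝ → ℕ → SwitchState n × ℝ} {u : ℝ → ℕ → EuclideanSpace ℝ (Fin m)}
    (h : ((switchingData f R τd N₀).toHybridSystem T k).IsSolutionPair E z u) :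
    (z 0 0).1.τ ∈ Icc 0 N₀ ∧ (∃ i : Fin N, (z 0 0).1.q = modeVal i) ∧ 1 ≤ (z 0 0).2 := by
  rcases h.init with h | h
  · exact ⟨h.1.1, h.1.2, h.2⟩
  · exact ⟨Icc_subset_Icc_left zero_le_one h.1.1, h.1.2, h.2⟩

theorem HybridSystem.IsSolutionPair.timerBound {n m N : ℕ}
    {f : Fin N → EuclideanSpace ℝ (Fin n) → EuclideanSpace ℝ (Fin m) → ℝ → ℝ →
      EuclideanSpace ℝ (Fin n)}
    {R : Fin N → EuclideanSpace ℝ (Fin n) → EuclideanSpace ℝ (Fin n)} {T k τd N₀ : ℝ}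
    {E : Set (ℝ × ℕ)} {z : ℝ → ℕ → SwitchState n × ℝ} {u : ℝ → ℕ → EuclideanSpace ℝ (Fin m)}
    (h : ((switchingData f R τd N₀).toHybridSystem T k).IsSolutionPair E z u)
    (hT : 0 < T) (hk : 1 ≤ k) {t : ℝ} {j : ℕ} (htj : (t, j) ∈ E) :
    TimerBound N T k τd N₀ (z 0 0) t j (z t j) := by
  obtain ⟨hτ0, hq0, hμ0⟩ := h.init_mem
  refine h.isHTD.induction (P := fun t j => TimerBound N T k τd N₀ (z 0 0) t j (z t j))
    ⟨hτ0, hq0, hμ0, by simp, by simpa [omegaFun_self] using hτ0.2⟩ htj ?_ ?_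
  · intro a b i hab _ _ hsub hP
    have hF := h.isFlowArc hab hsub
    have hbm : b ∈ Icc a b := right_mem_Icc.2 hab.le
    refine ⟨hF.τ_mem b hbm, hF.q_mem b hbm, hF.one_le b hbm, ?_, ?_⟩
    · rw [← hP.gain_eq]; exact hF.gain_eq hT hk
    · have := hF.τ_sub_le hT hk (z 0 0).2
      linarith [hP.dwell]
  · intro a i h1 h2 hP
    obtain ⟨hD, v, ⟨p, q, hp, hqp, rfl⟩, hz⟩ := h.jump a i h1 h2
    have hτD : (z a i).1.τ ∈ Icc 1 N₀ := hD.1.1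
    constructor <;> rw [hz] <;> simp only [SwitchState.τ_mk, SwitchState.q_mk]
    · exact ⟨by linarith [hτD.1], by linarith [hτD.2]⟩
    · exact ⟨q, rfl⟩
    · exact hP.one_le
    · exact hP.gain_eq
    · push_cast
      linarith [hP.dwell]

theorem HybridSystem.IsSolutionPair.lyapunovBound {n m N : ℕ}
    {f : Fin N → EuclideanSpace ℝ (Fin n) → EuclideanSpace ℝ (Fin m) → ℝ → ℝ →
      EuclideanSpace ℝ (Fin n)}
    {R : Fin N → EuclideanSpace ℝ (Fin n) → EuclideanSpace ℝ (Fin n)} {T k τd N₀ : ℝ}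
    {E : Set (ℝ × ℕ)} {z : ℝ → ℕ → SwitchState n × ℝ} {u : ℝ → ℕ → EuclideanSpace ℝ (Fin m)}
    (h : ((switchingData f R τd N₀).toHybridSystem T k).IsSolutionPair E z u)
    (hT : 0 < T) (hk : 1 ≤ k)
    {L : LyapunovData n N} {Δ : ℝ → ℝ} (hL : L.IsLyapunov f R τd N₀ Δ) (hΔ : ∀ μ, 1 ≤ μ → 0 ≤ Δ μ)
    {c K ℓ S : ℝ} (hc : ∀ i, c ≤ L.c₃ i) (hK : 0 ≤ K) (hℓ : 0 ≤ ℓ)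
    (hdom : ∀ i, ∀ μ, 1 ≤ μ → L.c₄ i * Δ μ * S ^ L.p ≤ (c - ℓ * (k / T)) * (K * μ ^ (-ℓ)))
    {t : ℝ} {j : ℕ} (htj : (t, j) ∈ E)
    (hS : ∀ t' j', (t', j') ∈ E → t' ≤ t → j' ≤ j → ‖u t' j'‖ ≤ S) :
    LyapunovBound L T k c K ℓ (z 0 0) (z t j) := by
  refine h.isHTD.induction (P := fun t j => LyapunovBound L T k c K ℓ (z 0 0) (z t j))
    (fun i _ => ⟨i, by simp [omegaFun_self]⟩) htj ?_ ?_
  · intro a b i hab hbt hij hsub hP q hq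
    have hF := h.isFlowArc hab hsub
    have hqa : (z a i).1.q = modeVal q := by
      rw [← hq]; exact (hF.q_eq (right_mem_Icc.2 hab.le)).symm
    obtain ⟨q₀, hq₀⟩ := hP q hqa
    exact ⟨q₀, (hF.lyapunov_le hT hk hL hΔ
      (fun s hs => hS s i (hsub hs) (hs.2.trans hbt) hij) hc hK hℓ hdom _ hqa).trans hq₀⟩
  · intro a i h1 h2 hP
    obtain ⟨hD, v, ⟨p, q, hp, hqp, rfl⟩, hz⟩ := h.jump a i h1 h2
    have hτD : (z a i).1.τ ∈ Icc 1 N₀ := hD.1.1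
    rw [hz]
    intro q' hq'
    obtain rfl := modeVal_injective hq'
    obtain ⟨q₀, hq₀⟩ := hP p hp
    refine ⟨q₀, le_trans ?_ hq₀⟩
    simp only [SwitchState.x_mk, SwitchState.τ_mk]
    -- The jump condition compares the Lyapunov functions of two different modes, so a switch costs
    -- no factor `r`.
    have hj := hL.jump p q hqp (z a i).1.x _ hτD
    have hW := hL.nonneg p (z a i).1.x (z a i).1.τ (by linarith [hτD.1])
    have := mul_le_of_le_one_left hW hL.χ_mem.2
    gcongr
    linarith

/-! ## Comparison functions -/

theorem isClassKL_mul {h : ℝ → ℝ} (h0 : ∀ s, 0 ≤ s → 0 ≤ h s) (hanti : AntitoneOn h (Ici 0))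
    (hlim : Tendsto h atTop (𝓝 0)) : IsClassKL (fun r s => h s * r) where
  nonneg r hr s hs := mul_nonneg (h0 s hs) hr
  monotoneOn s hs r _ r' _ hrr := mul_le_mul_of_nonneg_left hrr (h0 s hs)
  antitoneOn r hr s hs s' hs' hss := mul_le_mul_of_nonneg_right (hanti hs hs' hss) hr
  tendsto_left s _ := by
    have : Tendsto (fun r => h s * r) (𝓝 0) (𝓝 (h s * 0)) :=
      (continuous_const.mul continuous_id).tendsto 0
    rw [mul_zero] at this
    exact this.mono_left nhdsWithin_le_nhds
  tendsto_right r _ := by simpa using hlim.mul_const r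

theorem tendsto_exp_neg_mul_atTop {b : ℝ} (hb : 0 < b) :
    Tendsto (fun s : ℝ => Real.exp (-b * s)) atTop (𝓝 0) :=
  Real.tendsto_exp_atBot.comp (tendsto_id.const_mul_atTop_of_neg (neg_lt_zero.2 hb))

theorem isClassKLL_exp {a b : ℝ} (ha : 0 < a) (hb : 0 < b) :
    IsClassKLL (fun ρ s j => a * Real.exp (-b * (s + j)) * ρ) := by
  have key : ∀ s, IsClassKL (fun ρ t => a * Real.exp (-b * (s + t)) * ρ) := by
    intro s
    apply isClassKL_mul
    · intro t _; positivity
    · intro t _ t' _ htt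
      apply mul_le_mul_of_nonneg_left _ ha.le
      apply Real.exp_le_exp.2
      nlinarith
    · have := ((tendsto_exp_neg_mul_atTop hb).comp
        (tendsto_atTop_add_const_left atTop s tendsto_id))
      simpa using this.const_mul a
  intro s _
  -- The function depends on its last two arguments only through their sum, so one case gives both.
  exact ⟨key s, by simpa only [add_comm s] using key s⟩

theorem isClassK_const_mul {a : ℝ} (ha : 0 < a) : IsClassK (fun ρ => a * ρ) where
  continuousOn := by fun_prop
  strictMonoOn _ _ _ _ h := mul_lt_mul_of_pos_left h ha
  map_zero := mul_zero a

/-- The convergence rate for inputs whose effect is weighted by a negative power of the gain. -/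
def convergenceRate (T b ℓ p s : ℝ) : ℝ :=
  (Real.exp (-b * s) + (1 + s / T) ^ (-ℓ)) ^ (1 / p)

theorem isClassKL_convergenceRate {T b ℓ p : ℝ} (hT : 0 < T) (hb : 0 < b) (hℓ : 0 < ℓ)
    (hp : 0 < p) : IsClassKL (fun ρ s => convergenceRate T b ℓ p s * ρ) := by
  apply isClassKL_mul
  · intro s hs
    unfold convergenceRate
    positivity
  · intro s hs s' hs' hss
    have hs0 : (0 : ℝ) ≤ s := hs
    have hs0' : (0 : ℝ) ≤ s' := hs'
    unfold convergenceRate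
    apply Real.rpow_le_rpow (by positivity) _ (by positivity)
    apply add_le_add
    · apply Real.exp_le_exp.2; nlinarith
    · apply Real.rpow_le_rpow_of_nonpos (by positivity) _ (by linarith)
      gcongr
  · have h1 : Tendsto (fun s : ℝ => (1 + s / T) ^ (-ℓ)) atTop (𝓝 0) :=
      (tendsto_rpow_neg_atTop hℓ).comp
        (tendsto_atTop_add_const_left atTop 1 (tendsto_id.atTop_div_const hT))
    have h2 := ((tendsto_exp_neg_mul_atTop hb).add h1).rpow_const (p := 1 / p)
      (Or.inr (by positivity))
    simp only [add_zero, Real.zero_rpow (one_div_ne_zero hp.ne')] at h2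
    exact h2

/-! ## Constants -/

theorem ciInf_pos_of_finite {N : ℕ} [Nonempty (Fin N)] {c : Fin N → ℝ} (hc : ∀ q, 0 < c q) :
    0 < ⨅ q, c q := by
  obtain ⟨q, hq⟩ := exists_eq_ciInf_of_finite (f := c)
  rw [← hq]; exact hc q

theorem ciSup_pos_of_finite {N : ℕ} [hN : Nonempty (Fin N)] {c : Fin N → ℝ} (hc : ∀ q, 0 < c q) :
    0 < ⨆ q, c q :=
  (hc hN.some).trans_le (le_ciSup (Finite.bddAbove_range c) _)

namespace LyapunovData

variable {n m N : ℕ} {L : LyapunovData n N}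
  {f : Fin N → EuclideanSpace ℝ (Fin n) → EuclideanSpace ℝ (Fin m) → ℝ → ℝ →
    EuclideanSpace ℝ (Fin n)}
  {R : Fin N → EuclideanSpace ℝ (Fin n) → EuclideanSpace ℝ (Fin n)} {τd N₀ : ℝ} {Δ : ℝ → ℝ}

namespace IsLyapunov

theorem r_pos [Nonempty (Fin N)] (hL : L.IsLyapunov f R τd N₀ Δ) : 0 < L.r :=
  div_pos (ciSup_pos_of_finite hL.c₂_pos) (ciInf_pos_of_finite hL.c₁_pos)

/-- A unit vector in the sandwich bounds gives `c₁ ≤ c₂`. For `n = 0` there is none and `r < 1` is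
possible, which is why that dimension is treated apart. -/
theorem one_le_r [hN : Nonempty (Fin N)] (hL : L.IsLyapunov f R τd N₀ Δ)
    (hN₀ : 1 ≤ N₀) (hn : n ≠ 0) : 1 ≤ L.r := by
  rw [r, one_le_div (ciInf_pos_of_finite hL.c₁_pos)]
  have hn' : 0 < n := Nat.pos_of_ne_zero hn
  have h := hL.bounds hN.some (EuclideanSpace.single ⟨0, hn'⟩ 1) 0 ⟨le_rfl, by linarith⟩
  simp only [PiLp.norm_single, norm_one, Real.one_rpow, mul_one] at h
  exact (ciInf_le (Finite.bddBelow_range _) hN.some).trans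
    ((h.1.trans h.2).trans (le_ciSup (Finite.bddAbove_range L.c₂) hN.some))

theorem lam_pos [Nonempty (Fin N)] (hL : L.IsLyapunov f R τd N₀ Δ)
    (hτd : 0 < τd) (hdwell : Real.log L.r / (⨅ q, L.c₃ q) < τd) : 0 < L.lam τd := by
  have hc := ciInf_pos_of_finite hL.c₃_pos
  rw [div_lt_iff₀ hc] at hdwell
  rw [lam, sub_pos, div_lt_iff₀ hτd]
  linarith

theorem κ₁_pos [Nonempty (Fin N)] (hL : L.IsLyapunov f R τd N₀ Δ) : 0 < L.κ₁ τd N₀ := by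
  have := hL.r_pos
  unfold κ₁
  positivity

theorem κ₂_pos (hL : L.IsLyapunov f R τd N₀ Δ)
    (hτd : 0 < τd) (hlam : 0 < L.lam τd) : 0 < L.κ₂ τd := by
  have := hL.p_pos
  unfold κ₂
  positivity

theorem κ₃_pos [Nonempty (Fin N)] (hL : L.IsLyapunov f R τd N₀ Δ)
    (hlam : 0 < L.lam τd) : 0 < L.κ₃ τd N₀ := by
  have := hL.r_pos
  have := ciSup_pos_of_finite hL.c₄_pos
  have := ciInf_pos_of_finite hL.c₁_pos
  unfold κ₃
  positivity

theorem one_le_κ₁ (hL : L.IsLyapunov f R τd N₀ Δ)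
    (hN₀ : 1 ≤ N₀) (hτd : 0 < τd) (hlam : 0 < L.lam τd) (hr : 1 ≤ L.r) :
    1 ≤ L.κ₁ τd N₀ := by
  have hp := hL.p_pos
  have h1 : 1 ≤ L.r ^ N₀ := Real.one_le_rpow hr (by linarith)
  have h2 : 1 ≤ (L.r ^ N₀ * L.r) ^ (1 / L.p) :=
    Real.one_le_rpow (one_le_mul_of_one_le_of_one_le h1 hr) (by positivity)
  have h3 : 1 ≤ Real.exp (L.lam τd / (2 * L.p) * (τd / (1 + τd)) * N₀) :=
    Real.one_le_exp (by positivity)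
  exact one_le_mul_of_one_le_of_one_le h2 h3

theorem le_κ₃_rpow [Nonempty (Fin N)] (hL : L.IsLyapunov f R τd N₀ Δ)
    (hN₀ : 1 ≤ N₀) (hlam : 0 < L.lam τd) (hr : 1 ≤ L.r) :
    2 * (⨆ q, L.c₄ q) / (L.lam τd * (⨅ q, L.c₁ q)) ≤ L.κ₃ τd N₀ ^ L.p := by
  have := hL.r_pos
  have h4 := ciSup_pos_of_finite hL.c₄_pos
  have := ciInf_pos_of_finite hL.c₁_pos
  rw [κ₃, ← Real.rpow_mul (by positivity), one_div_mul_cancel hL.p_pos.ne', Real.rpow_one]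
  have h5 : 1 ≤ L.r ^ N₀ := Real.one_le_rpow hr (by linarith)
  exact div_le_div_of_nonneg_right (le_mul_of_one_le_right (by positivity) h5) (by positivity)

/-- The average dwell-time condition turns decay in the dilated time into decay in hybrid time. -/
theorem exp_le_decay [Nonempty (Fin N)] (hL : L.IsLyapunov f R τd N₀ Δ)
    (hN₀ : 1 ≤ N₀) (hτd : 0 < τd) (hlam : 0 < L.lam τd) (hr : 1 ≤ L.r) {s j : ℝ}
    (hj : j ≤ s / τd + N₀) :
    L.r * Real.exp (-(L.lam τd / 2) * s) ≤
      (L.κ₁ τd N₀ * Real.exp (-L.κ₂ τd * (s + j))) ^ L.p := by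
  have hp := hL.p_pos
  have hr0 := hL.r_pos
  have h1 : 1 ≤ L.r ^ N₀ := Real.one_le_rpow hr (by linarith)
  have e : (L.κ₁ τd N₀ * Real.exp (-L.κ₂ τd * (s + j))) ^ L.p =
      L.r ^ N₀ * L.r * Real.exp (-(L.lam τd / 2) * (τd / (1 + τd) * (s + j - N₀))) := by
    rw [κ₁, mul_assoc, ← Real.exp_add, Real.mul_rpow (by positivity) (by positivity),
      ← Real.rpow_mul (by positivity), one_div_mul_cancel hp.ne', Real.rpow_one, ← Real.exp_mul]
    congr 2
    unfold κ₂
    field_simp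
    ring
  rw [e]
  apply mul_le_mul (le_mul_of_one_le_left hr0.le h1) _ (by positivity) (by positivity)
  apply Real.exp_le_exp.2
  -- Adding `τd s` to `τd j ≤ s + τd N₀` gives `τd (s + j - N₀) ≤ (1 + τd) s`; this is the origin of
  -- `τd / (1 + τd)` in `κ₁` and `κ₂`.
  have h2 : τd / (1 + τd) * (s + j - N₀) ≤ s := by
    rw [div_mul_eq_mul_div, div_le_iff₀ (by linarith)]
    have : τd * j ≤ s + τd * N₀ := by
      calc τd * j ≤ τd * (s / τd + N₀) := mul_le_mul_of_nonneg_left hj hτd.le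
        _ = s + τd * N₀ := by field_simp
    nlinarith
  nlinarith

end IsLyapunov

end LyapunovData

/-! ## Norm bounds -/

section Bounds

variable {n m N : ℕ} {L : LyapunovData n N}
  {f : Fin N → EuclideanSpace ℝ (Fin n) → EuclideanSpace ℝ (Fin m) → ℝ → ℝ →
    EuclideanSpace ℝ (Fin n)}
  {R : Fin N → EuclideanSpace ℝ (Fin n) → EuclideanSpace ℝ (Fin n)} {τd N₀ : ℝ} {Δ : ℝ → ℝ}
  {T k c K ℓ t : ℝ} {j : ℕ} {z₀ z : SwitchState n × ℝ}

theorem TimerBound.gain_mono (h : TimerBound N T k τd N₀ z₀ t j z) (hT : 0 < T) (hk : 1 ≤ k)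
    (hz₀ : 1 ≤ z₀.2) (ht : 0 ≤ t) : z₀.2 ≤ z.2 := by
  have hk0 : 0 < k := by linarith
  have h1 : z.2 ^ (-(1 / k)) ≤ z₀.2 ^ (-(1 / k)) := by
    rw [← h.gain_eq]
    have : 0 ≤ t / T := by positivity
    linarith
  exact (Real.rpow_le_rpow_iff_of_neg (by linarith [h.one_le]) (by linarith)
    (neg_lt_zero.2 (by positivity))).1 h1

theorem LyapunovBound.norm_rpow_le [Nonempty (Fin N)] (hV : LyapunovBound L T k c K ℓ z₀ z)
    (h : TimerBound N T k τd N₀ z₀ t j z)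
    (hL : L.IsLyapunov f R τd N₀ Δ) (hτ₀ : z₀.1.τ ∈ Icc 0 N₀) :
    (⨅ q, L.c₁ q) * ‖z.1.x‖ ^ L.p ≤ Real.exp (-(c * omegaFun T k z.2 z₀.2)) *
      ((⨆ q, L.c₂ q) * ‖z₀.1.x‖ ^ L.p - K * z₀.2 ^ (-ℓ)) + K * z.2 ^ (-ℓ) := by
  obtain ⟨i, hi⟩ := h.q_mem
  obtain ⟨i₀, hi₀⟩ := hV i hi
  have h1 := (hL.bounds i z.1.x _ h.τ_mem).1
  have h2 := (hL.bounds i₀ z₀.1.x _ hτ₀).2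
  have h3 : (⨅ q, L.c₁ q) * ‖z.1.x‖ ^ L.p ≤ L.c₁ i * ‖z.1.x‖ ^ L.p := by
    gcongr
    exact ciInf_le (Finite.bddBelow_range _) i
  have h4 : L.c₂ i₀ * ‖z₀.1.x‖ ^ L.p ≤ (⨆ q, L.c₂ q) * ‖z₀.1.x‖ ^ L.p := by
    gcongr
    exact le_ciSup (Finite.bddAbove_range L.c₂) i₀
  have h5 : L.V i (z.1.x, z.1.τ) - K * z.2 ^ (-ℓ) ≤ Real.exp (-(c * omegaFun T k z.2 z₀.2)) *
      (L.V i₀ (z₀.1.x, z₀.1.τ) - K * z₀.2 ^ (-ℓ)) := by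
    rw [Real.exp_neg, ← div_eq_inv_mul, le_div_iff₀ (Real.exp_pos _), mul_comm]
    exact hi₀
  have h6 := mul_le_mul_of_nonneg_left (h2.trans h4)
    (Real.exp_pos (-(c * omegaFun T k z.2 z₀.2))).le
  linarith

/-- A maximum, unlike a sum, passes through the `p`-th root without a constant depending on `p`,
even for `p < 1`. -/
theorem le_add_of_rpow_le_max {y A B p : ℝ} (hp : 0 < p) (hy : 0 ≤ y) (hA : 0 ≤ A) (hB : 0 ≤ B)
    (h : y ^ p ≤ max (A ^ p) (B ^ p)) : y ≤ A + B := by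
  rcases le_max_iff.1 h with h | h
  · linarith [(Real.rpow_le_rpow_iff hy hA hp).1 h]
  · linarith [(Real.rpow_le_rpow_iff hy hB hp).1 h]

/-- Since `(1 - θ²) B = (1 - θ)(1 + θ) B ≤ (1 - θ) 2B`, the left side is at most the convex
combination of `θ A` and `2B` with weights `θ` and `1 - θ`. With `θ = e^(-λs/2)` this explains the
halved rate in `κ₂` and the factor `2` in `κ₃`. -/
theorem convex_comb_le_max {θ A B : ℝ} (h0 : 0 ≤ θ) (h1 : θ ≤ 1) (hB : 0 ≤ B) :
    θ * θ * A + (1 - θ * θ) * B ≤ max (θ * A) (2 * B) := by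
  have hm1 := le_max_left (θ * A) (2 * B)
  have hm2 := le_max_right (θ * A) (2 * B)
  nlinarith [mul_le_mul_of_nonneg_left hm1 h0, mul_le_mul_of_nonneg_left hm2 (sub_nonneg.2 h1),
    mul_nonneg (sub_nonneg.2 h1) (mul_nonneg (sub_nonneg.2 h1) hB)]

/-- The ISS estimate when the effect of the input is constant in the gain. -/
theorem LyapunovBound.norm_le [Nonempty (Fin N)]
    (hV : LyapunovBound L T k (L.lam τd) K 0 z₀ z)
    (h : TimerBound N T k τd N₀ z₀ t j z)
    (hL : L.IsLyapunov f R τd N₀ Δ) (hτ₀ : z₀.1.τ ∈ Icc 0 N₀) (hz₀ : 1 ≤ z₀.2) (hN₀ : 1 ≤ N₀)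
    (hτd : 0 < τd) (hlam : 0 < L.lam τd) (hT : 0 < T) (hk : 1 ≤ k) (ht : 0 ≤ t) (hK : 0 ≤ K)
    (hr : 1 ≤ L.r) {B : ℝ} (hB : 0 ≤ B) (hKB : 2 * (K / ⨅ q, L.c₁ q) ≤ B ^ L.p) :
    ‖z.1.x‖ ≤ L.κ₁ τd N₀ * Real.exp (-L.κ₂ τd * (omegaFun T k z.2 z₀.2 + j)) * ‖z₀.1.x‖ + B := by
  have hc1 := ciInf_pos_of_finite hL.c₁_pos
  have hω := omegaFun_nonneg hT hk hz₀ (h.gain_mono hT hk hz₀ ht)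
  have hn := hV.norm_rpow_le h hL hτ₀
  have hj : (j : ℝ) ≤ omegaFun T k z.2 z₀.2 / τd + N₀ := by linarith [h.dwell, h.τ_mem.1]
  have hd := hL.exp_le_decay hN₀ hτd hlam hr hj
  have hκ := hL.κ₁_pos
  set s := omegaFun T k z.2 z₀.2
  set θ := Real.exp (-(L.lam τd / 2) * s) with hθ
  have hθ1 : θ ≤ 1 := Real.exp_le_one_iff.2 (by nlinarith)
  have hθθ : Real.exp (-(L.lam τd * s)) = θ * θ := by
    rw [hθ, ← Real.exp_add]; ring_nf
  apply le_add_of_rpow_le_max hL.p_pos (norm_nonneg _) (by positivity) hB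
  rw [Real.mul_rpow (by positivity) (norm_nonneg _)]
  calc ‖z.1.x‖ ^ L.p
      ≤ θ * θ * (L.r * ‖z₀.1.x‖ ^ L.p) + (1 - θ * θ) * (K / ⨅ q, L.c₁ q) := by
        rw [hθθ] at hn
        simp only [neg_zero, Real.rpow_zero, mul_one] at hn
        rw [← mul_le_mul_iff_right₀ hc1]
        refine hn.trans (le_of_eq ?_)
        unfold LyapunovData.r
        field_simp
        ring
    _ ≤ max (θ * (L.r * ‖z₀.1.x‖ ^ L.p)) (2 * (K / ⨅ q, L.c₁ q)) :=
        convex_comb_le_max (Real.exp_pos _).le hθ1 (by positivity)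
    _ ≤ _ := by
        apply max_le_max _ hKB
        rw [← mul_assoc, mul_comm θ]
        gcongr

/-- The ISS estimate with convergence when the effect of the input vanishes for large gains. -/
theorem LyapunovBound.norm_le_convergenceRate [Nonempty (Fin N)]
    (hV : LyapunovBound L T k (L.lam τd) K ℓ z₀ z)
    (h : TimerBound N T k τd N₀ z₀ t j z)
    (hL : L.IsLyapunov f R τd N₀ Δ) (hτ₀ : z₀.1.τ ∈ Icc 0 N₀) (hz₀ : 1 ≤ z₀.2) (hN₀ : 1 ≤ N₀)
    (hτd : 0 < τd) (hlam : 0 < L.lam τd) (hT : 0 < T) (hk : 1 ≤ k) (ht : 0 ≤ t) (hK : 0 ≤ K)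
    (hℓ : 0 ≤ ℓ) (hr : 1 ≤ L.r) {B : ℝ} (hB : 0 ≤ B) (hKB : K / (⨅ q, L.c₁ q) ≤ B ^ L.p) :
    ‖z.1.x‖ ≤ convergenceRate T (L.lam τd / 2) ℓ L.p (omegaFun T k z.2 z₀.2) *
      (L.κ₁ τd N₀ ^ 2 * Real.exp (-(L.κ₂ τd / 2) * (omegaFun T k z.2 z₀.2 + j)) * ‖z₀.1.x‖
        + B) := by
  have hc1 := ciInf_pos_of_finite hL.c₁_pos
  have hp := hL.p_pos
  have hμ := h.gain_mono hT hk hz₀ ht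
  have hω := omegaFun_nonneg hT hk hz₀ hμ
  have hω' := omegaFun_le hT hk hz₀ hμ
  have hn := hV.norm_rpow_le h hL hτ₀
  have hj : (j : ℝ) ≤ omegaFun T k z.2 z₀.2 / τd + N₀ := by linarith [h.dwell, h.τ_mem.1]
  have hd := hL.exp_le_decay hN₀ hτd hlam hr hj
  have hκ := hL.one_le_κ₁ hN₀ hτd hlam hr
  have hκ₂ := hL.κ₂_pos hτd hlam
  set s := omegaFun T k z.2 z₀.2
  set θ := Real.exp (-(L.lam τd / 2) * s) with hθ
  have hθ0 : 0 < θ := Real.exp_pos _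
  have hθθ : Real.exp (-(L.lam τd * s)) = θ * θ := by
    rw [hθ, ← Real.exp_add]; ring_nf
  set A := L.κ₁ τd N₀ ^ 2 * Real.exp (-(L.κ₂ τd / 2) * (s + j)) * ‖z₀.1.x‖ with hA
  have hA0 : 0 ≤ A := by positivity
  -- Of `e^(-λs) = θ²`, one factor `θ` yields the decay in `s + j` and the other is kept for the
  -- convergence rate. Squaring `κ₁` and halving `κ₂` only weakens the bound, as `κ₁ ≥ 1` and `κ₂ >
  -- 0`.
  have hdA : L.r * θ * ‖z₀.1.x‖ ^ L.p ≤ A ^ L.p := by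
    rw [hA, Real.mul_rpow (by positivity) (norm_nonneg _)]
    gcongr
    refine hd.trans ?_
    have : (0 : ℝ) ≤ j := Nat.cast_nonneg j
    gcongr
    · exact le_self_pow₀ hκ two_ne_zero
    · linarith
  have hgain : z.2 ^ (-ℓ) ≤ (1 + s / T) ^ (-ℓ) := by
    apply Real.rpow_le_rpow_of_nonpos (by positivity) _ (by linarith)
    have : s / T ≤ z.2 - z₀.2 := by
      rw [div_le_iff₀ hT]; linarith
    linarith
  have hmono : ∀ C, 0 ≤ C → C ≤ A + B → C ^ L.p ≤ (A + B) ^ L.p :=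
    fun C h0 h1 => Real.rpow_le_rpow h0 h1 hp.le
  have hz0 : 0 < z.2 := by linarith
  have key : ‖z.1.x‖ ^ L.p ≤ (θ + (1 + s / T) ^ (-ℓ)) * (A + B) ^ L.p := by
    calc ‖z.1.x‖ ^ L.p
        ≤ θ * (L.r * θ * ‖z₀.1.x‖ ^ L.p) + z.2 ^ (-ℓ) * (K / ⨅ q, L.c₁ q) := by
          rw [hθθ] at hn
          rw [← mul_le_mul_iff_right₀ hc1]
          -- The initial value of the supersolution enters with a negative sign and is discarded.
          have h0 : 0 ≤ θ * θ * (K * z₀.2 ^ (-ℓ)) := by positivity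
          have e : (⨅ q, L.c₁ q) * (θ * (L.r * θ * ‖z₀.1.x‖ ^ L.p) +
              z.2 ^ (-ℓ) * (K / ⨅ q, L.c₁ q)) =
              θ * θ * ((⨆ q, L.c₂ q) * ‖z₀.1.x‖ ^ L.p) + K * z.2 ^ (-ℓ) := by
            unfold LyapunovData.r
            field_simp
          rw [e]
          linarith
      _ ≤ θ * (A + B) ^ L.p + (1 + s / T) ^ (-ℓ) * (A + B) ^ L.p := by
          gcongr
          · exact hdA.trans (hmono A hA0 (by linarith))
          · exact hKB.trans (hmono B hB (by linarith))
      _ = _ := by ring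
  rw [← Real.rpow_le_rpow_iff (norm_nonneg _) _ hp]
  · rw [Real.mul_rpow (by unfold convergenceRate; positivity) (by positivity), convergenceRate,
      ← Real.rpow_mul (by positivity), one_div_mul_cancel hp.ne', Real.rpow_one]
    exact key
  · unfold convergenceRate
    positivity

end Bounds

/-! ## The main theorem -/

section Main

variable {n m N : ℕ} {L : LyapunovData n N}
  {f : Fin N → EuclideanSpace ℝ (Fin n) → EuclideanSpace ℝ (Fin m) → ℝ → ℝ →
    EuclideanSpace ℝ (Fin n)}
  {R : Fin N → EuclideanSpace ℝ (Fin n) → EuclideanSpace ℝ (Fin n)} {τd N₀ T k : ℝ} {Δ : ℝ → ℝ}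

theorem supInput_nonneg {U : Type*} [NormedAddCommGroup U] (E : Set (ℝ × ℕ)) (u : ℝ → ℕ → U)
    (t : ℝ) (j : ℕ) : 0 ≤ supInput E u t j := by
  apply Real.sSup_nonneg
  rintro _ ⟨t', j', _, _, _, rfl⟩
  exact norm_nonneg _

theorem norm_le_supInput {U : Type*} [NormedAddCommGroup U] {E : Set (ℝ × ℕ)} {u : ℝ → ℕ → U}
    {t : ℝ} {j : ℕ} (h : BddAbove (inputNorms E u t j)) (t' : ℝ) (j' : ℕ) (hE : (t', j') ∈ E)
    (ht : t' ≤ t) (hj : j' ≤ j) : ‖u t' j'‖ ≤ supInput E u t j :=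
  le_csSup h ⟨t', j', hE, ht, hj, rfl⟩

theorem TimerBound.dilatedTime_eq {t : ℝ} {j : ℕ} {z₀ z : SwitchState n × ℝ}
    (h : TimerBound N T k τd N₀ z₀ t j z) (hT : 0 < T) (hk : 1 ≤ k) :
    dilatedTime T k z₀.2 t = omegaFun T k z.2 z₀.2 := by
  rw [dilatedTime, blowUpGain_eq hT hk h.one_le h.gain_eq]

theorem LyapunovData.lam_le_c₃ (hτd : 0 < τd) (hr : 1 ≤ L.r) (i : Fin N) :
    L.lam τd ≤ L.c₃ i := by
  have h1 : 0 ≤ Real.log L.r / τd := div_nonneg (Real.log_nonneg hr) hτd.le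
  have h2 : (⨅ q, L.c₃ q) ≤ L.c₃ i := ciInf_le (Finite.bddBelow_range _) i
  unfold lam
  linarith

variable [Nonempty (Fin N)]

/-- If the weight of the input is a constant `δ`, all solution pairs obey an ISS estimate. -/
theorem LyapunovData.IsLyapunov.issBound {δ : ℝ} (hL : L.IsLyapunov f R τd N₀ (fun _ => δ))
    (hT : 0 < T) (hk : 1 ≤ k) (hτd : 0 < τd) (hN₀ : 1 ≤ N₀) (hlam : 0 < L.lam τd)
    (hδ : 0 ≤ δ) {g : ℝ} (hg : 0 ≤ g)
    -- Conditional on `1 ≤ r`, because `κ₃` dominates the left side only through `r^N₀ ≥ 1`.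
    (hδg : 1 ≤ L.r → 2 * (⨆ q, L.c₄ q) / (L.lam τd * (⨅ q, L.c₁ q)) * δ ≤ g ^ L.p) :
    (switchingData f R τd N₀).ISSBound T k (switchingTarget n N N₀)
      (fun ρ s j => L.κ₁ τd N₀ * Real.exp (-L.κ₂ τd * (s + j)) * ρ) (fun ρ => g * ρ) := by
  intro E z u h t j htj hbdd
  obtain ⟨hτ0, hq0, hμ0⟩ := h.init_mem
  have hS0 := supInput_nonneg E u t j
  have hκ := hL.κ₁_pos
  have hc1 := ciInf_pos_of_finite hL.c₁_pos
  have hc4 := ciSup_pos_of_finite hL.c₄_pos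
  have hB := h.timerBound hT hk htj
  rw [euclDist_switchingTarget hB.τ_mem hB.q_mem hB.one_le,
    euclDist_switchingTarget hτ0 hq0 hμ0, hB.dilatedTime_eq hT hk]
  by_cases hn : n = 0
  · subst hn
    rw [Subsingleton.elim (z t j).1.x 0, norm_zero]
    positivity
  have hr := hL.one_le_r hN₀ hn
  have hV := h.lyapunovBound hT hk hL (fun _ _ => hδ) (S := supInput E u t j)
    (K := (⨆ q, L.c₄ q) * δ * supInput E u t j ^ L.p / L.lam τd) (ℓ := 0)
    (lam_le_c₃ hτd hr) (by positivity) le_rfl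
    (fun i μ _ => by
      rw [zero_mul, sub_zero, neg_zero, Real.rpow_zero, mul_one, mul_div_cancel₀ _ hlam.ne']
      gcongr
      exact le_ciSup (Finite.bddAbove_range L.c₄) i)
    htj (norm_le_supInput hbdd)
  refine hV.norm_le hB hL hτ0 hμ0 hN₀ hτd hlam hT hk (h.isHTD.1 _ htj) (by positivity) hr
    (by positivity) ?_
  rw [Real.mul_rpow hg hS0]
  refine le_trans (le_of_eq ?_) (mul_le_mul_of_nonneg_right (hδg hr) (by positivity))
  field_simp

/-- If the weight of the input is a negative power of the gain, all solution pairs obey an ISS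
estimate with convergence. -/
theorem LyapunovData.IsLyapunov.convergentISSBound {ℓ : ℝ}
    (hL : L.IsLyapunov f R τd N₀ (fun μ => μ ^ (-ℓ)))
    (hT : 0 < T) (hk : 1 ≤ k) (hτd : 0 < τd) (hN₀ : 1 ≤ N₀) (hlam : 0 < L.lam τd) (hℓ : 0 < ℓ) :
    (switchingData f R τd N₀).ConvergentISSBound T k (switchingTarget n N N₀)
      (fun ρ s j => L.κ₁ τd N₀ ^ 2 * Real.exp (-(L.κ₂ τd / 2) * (s + j)) * ρ)
      (fun ρ => 2 * L.κ₁ τd N₀ * L.κ₃ τd N₀ * ρ)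
      (fun ρ s => convergenceRate T (L.lam τd / 2) (min ℓ (L.lam τd * T / (2 * k))) L.p s * ρ) := by
  intro E z u h t j htj hbdd
  obtain ⟨hτ0, hq0, hμ0⟩ := h.init_mem
  have hk0 : 0 < k := by linarith
  have hp := hL.p_pos
  have hS0 := supInput_nonneg E u t j
  have hκ := hL.κ₁_pos
  have hκ₃ := hL.κ₃_pos hlam
  have hc1 := ciInf_pos_of_finite hL.c₁_pos
  have hc4 := ciSup_pos_of_finite hL.c₄_pos
  have hB := h.timerBound hT hk htj
  have hω := omegaFun_nonneg hT hk hμ0 (hB.gain_mono hT hk hμ0 (h.isHTD.1 _ htj))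
  rw [euclDist_switchingTarget hB.τ_mem hB.q_mem hB.one_le,
    euclDist_switchingTarget hτ0 hq0 hμ0, hB.dilatedTime_eq hT hk]
  by_cases hn : n = 0
  · subst hn
    rw [Subsingleton.elim (z t j).1.x 0, norm_zero]
    unfold convergenceRate
    positivity
  have hr := hL.one_le_r hN₀ hn
  -- The exponent is capped so that the supersolution decays no faster than `λ/2` in dilated time.
  -- The other half of `λ` absorbs the input, whence the factor `2` in `K` below.
  set ℓ' := min ℓ (L.lam τd * T / (2 * k)) with hℓ'
  have hℓ'0 : 0 < ℓ' := lt_min hℓ (by positivity)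
  have hrate : ℓ' * (k / T) ≤ L.lam τd / 2 := by
    calc ℓ' * (k / T) ≤ L.lam τd * T / (2 * k) * (k / T) := by
          gcongr; exact min_le_right _ _
      _ = L.lam τd / 2 := by field_simp
  have hV := h.lyapunovBound hT hk hL (fun μ hμ => Real.rpow_nonneg (by linarith) _)
    (S := supInput E u t j)
    (K := 2 * (⨆ q, L.c₄ q) * supInput E u t j ^ L.p / L.lam τd) (ℓ := ℓ')
    (lam_le_c₃ hτd hr) (by positivity) hℓ'0.le
    (fun i μ hμ => by
      have hμ0 : 0 < μ := by linarith
      have h4 : L.c₄ i ≤ ⨆ q, L.c₄ q := le_ciSup (Finite.bddAbove_range L.c₄) i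
      have h5 : μ ^ (-ℓ) ≤ μ ^ (-ℓ') :=
        Real.rpow_le_rpow_of_exponent_le hμ (neg_le_neg (min_le_left _ _))
      calc L.c₄ i * μ ^ (-ℓ) * supInput E u t j ^ L.p
          ≤ (⨆ q, L.c₄ q) * μ ^ (-ℓ') * supInput E u t j ^ L.p := by gcongr
        _ = L.lam τd / 2 *
            (2 * (⨆ q, L.c₄ q) * supInput E u t j ^ L.p / L.lam τd * μ ^ (-ℓ')) := by
          field_simp
        _ ≤ _ := by
          apply mul_le_mul_of_nonneg_right _ (by positivity)
          linarith)
    htj (norm_le_supInput hbdd)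
  refine hV.norm_le_convergenceRate hB hL hτ0 hμ0 hN₀ hτd hlam hT hk (h.isHTD.1 _ htj)
    (by positivity) hℓ'0.le hr (by positivity) ?_
  have hκ1 := hL.one_le_κ₁ hN₀ hτd hlam hr
  have h6 : L.κ₃ τd N₀ ≤ 2 * L.κ₁ τd N₀ * L.κ₃ τd N₀ :=
    le_mul_of_one_le_left hκ₃.le (by linarith)
  rw [Real.mul_rpow (by positivity) hS0]
  calc _ = 2 * (⨆ q, L.c₄ q) / (L.lam τd * (⨅ q, L.c₁ q)) * supInput E u t j ^ L.p := by
        field_simp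
    _ ≤ L.κ₃ τd N₀ ^ L.p * supInput E u t j ^ L.p := by
        gcongr
        exact hL.le_κ₃_rpow hN₀ hlam hr
    _ ≤ _ := by gcongr

theorem PTData.ISSBound.isPTS {Ψ U : Type*} [NormedAddCommGroup Ψ] [NormedSpace ℝ Ψ]
    [NormedAddCommGroup U] {P : PTData Ψ U} {A₁ : Set Ψ} {β : ℝ → ℝ → ℝ → ℝ}
    (h : P.ISSBound T k A₁ β (fun _ => 0)) (hβ : IsClassKLL β) : P.IsPTS T k A₁ := by
  refine ⟨β, hβ, fun E z u hz hu t j htj => ?_⟩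
  have hb : BddAbove (inputNorms E u t j) := by
    refine ⟨0, ?_⟩
    rintro _ ⟨t', j', hE, _, _, rfl⟩
    rw [hu t' j' hE, norm_zero]
  simpa using h E z u hz t j htj hb

end Main

end

theorem theorem1 {n m N : ℕ} (hN : 1 ≤ N)
    (f : Fin N → EuclideanSpace ℝ (Fin n) → EuclideanSpace ℝ (Fin m) → ℝ → ℝ →
      EuclideanSpace ℝ (Fin n))
    (R : Fin N → EuclideanSpace ℝ (Fin n) → EuclideanSpace ℝ (Fin n))
    (hreg : RegularModes f R)
    (T k : ℝ) (hT : 0 < T) (hk : 1 ≤ k)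
    (τd N₀ : ℝ) (hτd : 0 < τd) (hN₀ : 1 ≤ N₀)
    (L : LyapunovData n N) (hdwell : Real.log L.r / (⨅ q, L.c₃ q) < τd) :
    (L.IsLyapunov f R τd N₀ (fun _ => 0) →
      (switchingData f R τd N₀).IsPTS T k (switchingTarget n N N₀) ∧
      (switchingData f R τd N₀).ISSBound T k (switchingTarget n N N₀)
        (fun ρ s j => L.κ₁ τd N₀ * Real.exp (-L.κ₂ τd * (s + j)) * ρ) (fun _ => 0)) ∧
    (L.IsLyapunov f R τd N₀ (fun _ => 1) →
      (switchingData f R τd N₀).IsPTISS T k (switchingTarget n N N₀) ∧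
      (switchingData f R τd N₀).ISSBound T k (switchingTarget n N N₀)
        (fun ρ s j => L.κ₁ τd N₀ * Real.exp (-L.κ₂ τd * (s + j)) * ρ)
        (fun ρ => L.κ₃ τd N₀ * ρ)) ∧
    (∀ ℓ : ℝ, 0 < ℓ → L.IsLyapunov f R τd N₀ (fun μ => μ ^ (-ℓ)) →
      (switchingData f R τd N₀).IsPTISSC T k (switchingTarget n N N₀) ∧
      ∃ βc, IsClassKL βc ∧
        (switchingData f R τd N₀).ConvergentISSBound T k (switchingTarget n N N₀)
          (fun ρ s j => L.κ₁ τd N₀ ^ 2 * Real.exp (-(L.κ₂ τd / 2) * (s + j)) * ρ)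
          (fun ρ => 2 * L.κ₁ τd N₀ * L.κ₃ τd N₀ * ρ) βc) := by
  have : Nonempty (Fin N) := ⟨⟨0, hN⟩⟩
  refine ⟨fun hL => ?_, fun hL => ?_, fun ℓ hℓ hL => ?_⟩
  · have hlam := hL.lam_pos hτd hdwell
    have hb := hL.issBound hT hk hτd hN₀ hlam le_rfl le_rfl
      (fun _ => by rw [mul_zero, Real.zero_rpow hL.p_pos.ne'])
    simp only [zero_mul] at hb
    exact ⟨hb.isPTS (isClassKLL_exp hL.κ₁_pos (hL.κ₂_pos hτd hlam)), hb⟩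
  · have hlam := hL.lam_pos hτd hdwell
    have hκ₃ : 0 < L.κ₃ τd N₀ := hL.κ₃_pos hlam
    have hb := hL.issBound hT hk hτd hN₀ hlam zero_le_one hκ₃.le
      (fun hr => by rw [mul_one]; exact hL.le_κ₃_rpow hN₀ hlam hr)
    exact ⟨⟨_, _, isClassKLL_exp hL.κ₁_pos (hL.κ₂_pos hτd hlam), isClassK_const_mul hκ₃, hb⟩, hb⟩
  · have hlam := hL.lam_pos hτd hdwell
    have hκ₁ : 0 < L.κ₁ τd N₀ := hL.κ₁_pos
    have hκ₃ : 0 < L.κ₃ τd N₀ := hL.κ₃_pos hlam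
    have hb := hL.convergentISSBound hT hk hτd hN₀ hlam hℓ
    have hβc : IsClassKL (fun ρ s =>
        convergenceRate T (L.lam τd / 2) (min ℓ (L.lam τd * T / (2 * k))) L.p s * ρ) :=
      isClassKL_convergenceRate hT (half_pos hlam) (lt_min hℓ (by positivity)) hL.p_pos
    exact ⟨⟨_, _, _, isClassKLL_exp (by positivity) (half_pos (hL.κ₂_pos hτd hlam)),
      isClassK_const_mul (by positivity), hβc, hb⟩, _, hβc, hb⟩
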